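/- **Setting.** Fix $a>0$ and let $\mathbf v_1=a(\tfrac{\sqrt3}{2},\tfrac12)$, $\mathbf v_2=a(\tfrac{\sqrt3}{2},-\tfrac12)$, $\Lambda=\mathbb Z\mathbf v_1\oplus\mathbb Z\mathbf v_2$, $\Gamma=\mathbb R^2/\Lambda$. Let $\mathbf k_1=\frac{4\pi}{a\sqrt3}(\tfrac12,\tfrac{\sqrt3}2)$, $\mathbf k_2=\frac{4\pi}{a\sqrt3}(\tfrac12,-\tfrac{\sqrt3}2)$ generate the dual lattice $\Lambda^*$, put $\xi_{\mathbf m}=m_1\mathbf k_1+m_2\mathbf k_2$ for $\mathbf m\in\mathbb Z^2$, let $\mathcal B$ be a fundamental domain of $\Lambda^*$ (the hexagonal Brillouin zone), and let $\mathbf K=\frac23\mathbf k_1+\frac13\mathbf k_2$ (a Dirac point). For $\mathbf k\in\mathbb R^2$ let $L^2_{\mathbf k}(\Gamma)$ be the space of functions that are square integrable over $\Gamma$ with $f(\mathbf x+\mathbf v_j)=e^{i\mathbf k\cdot\mathbf v_j}f(\mathbf x)$, $j=1,2$, and let $\hat f_{\mathbf m}=\mathrm{area}(\Gamma)^{-1/2}\int_\Gamma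 e^{-i(\xi_{\mathbf m}+\mathbf k)\cdot\mathbf x}f(\mathbf x)\,d\mathbf x$. For $\alpha\in\mathbb R$, the point scatterer $-\Delta_{\alpha,\{\mathbf 0\}}(\mathbf k)$ is the self-adjoint operator in $L^2_{\mathbf k}(\Gamma)$ whose resolvent $\psi=(-\Delta_{\alpha,\{\mathbf 0\}}(\mathbf k)-\lambda)^{-1}h$ is, for real $\lambda\notin\{|\xi_{\mathbf m}+\mathbf k|^2\}$ with $\alpha\ne g_\lambda(\mathbf 0,\mathbf k)$, $$\hat\psi_{\mathbf m}=\frac{\hat h_{\mathbf m}}{|\xi_{\mathbf m}+\mathbf k|^2-\lambda}+\frac{1}{\mathrm{area}(\Gamma)}\,\frac{1}{\alpha-g_\lambda(\mathbf 0,\mathbf k)}\Bigl(\sum_{\mathbf n\in\mathbb Z^2}\frac{\hat h_{\mathbf n}}{|\xi_{\mathbf n}+\mathbf k|^2-\lambda}\Bigr)\frac{1}{|\xi_{\mathbf m}+\mathbf k|^2-\lambda},$$ $$g_\lambda(\mathbf 0,\mathbf k)=\frac1{\mathrm{area}(\Gamma)}\lim_{r\to\infty}\Bigl[\sum_{|\xi_{\mathbf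 m}+\mathbf k|\le r}\frac1{|\xi_{\mathbf m}+\mathbf k|^2-\lambda}-\frac{2\pi}{\mathrm{area}(\mathcal B)}\ln r\Bigr].$$ **Theorem.** Let $\alpha\in\mathbb R$ and let $\nu_1(\mathbf k,\alpha)\le\nu_2(\mathbf k,\alpha)\le\cdots$ be the eigenvalues of $-\Delta_{\alpha,\{\mathbf 0\}}(\mathbf k)$, counted with multiplicity. For all $\mathbf k$ near $\mathbf K$ the second and third eigenvalues exist, and as $\mathbf k\to\mathbf K$ $$\nu_2(\mathbf k,\alpha)=|\mathbf K|^2-\frac{4\pi}{3a}|\mathbf k-\mathbf K|+o(|\mathbf k-\mathbf K|),\qquad \nu_3(\mathbf k,\alpha)=|\mathbf K|^2+\frac{4\pi}{3a}|\mathbf k-\mathbf K|+o(|\mathbf k-\mathbf K|),$$ uniformly in the direction of $\mathbf k-\mathbf K$; moreover $\nu_2(\mathbf K,\alpha)=\nu_3(\mathbf K,\alpha)=|\mathbf K|^2$. -/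

import Mathlib

open MeasureTheory Filter Topology Asymptotics

noncomputable section

namespace PointScatterer

/-- The Euclidean plane. -/
abbrev Plane : Type := EuclideanSpace ℝ (Fin 2)

/-! ### The triangular lattice and its dual -/

/-- First generator of the triangular lattice `Λ` with lattice constant `a`. -/
def v₁ (a : ℝ) : Plane := a • !₂[√3 / 2, 1 / 2]

/-- Second generator of the triangular lattice `Λ`. -/
def v₂ (a : ℝ) : Plane := a • !₂[√3 / 2, -1 / 2]

/-- First generator of the dual lattice `Λ*`; `k₁ ⬝ v₁ = 2π`, `k₁ ⬝ v₂ = 0`. -/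
def k₁ (a : ℝ) : Plane := (4 * Real.pi / (a * √3)) • !₂[1 / 2, √3 / 2]

/-- Second generator of the dual lattice `Λ*`; `k₂ ⬝ v₁ = 0`, `k₂ ⬝ v₂ = 2π`. -/
def k₂ (a : ℝ) : Plane := (4 * Real.pi / (a * √3)) • !₂[1 / 2, -√3 / 2]

/-- The dual lattice vector `ξ_m = m₁ k₁ + m₂ k₂`. -/
def dualVec (a : ℝ) (m : ℤ × ℤ) : Plane := (m.1 : ℝ) • k₁ a + (m.2 : ℝ) • k₂ a

/-- The Dirac point `K = (2/3) k₁ + (1/3) k₂`, a vertex of the hexagonal Brillouin zone. -/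
def diracPoint (a : ℝ) : Plane := (2 / 3 : ℝ) • k₁ a + (1 / 3 : ℝ) • k₂ a

/-- The half-open parallelogram `{s v₁ + t v₂ : 0 ≤ s, t < 1}`, a set of representatives of the
fundamental domain `Γ = ℝ² / Λ`. -/
def cell (a : ℝ) : Set Plane :=
  (fun p : ℝ × ℝ => p.1 • v₁ a + p.2 • v₂ a) '' (Set.Ico 0 1 ×ˢ Set.Ico 0 1)

/-- The area of a fundamental domain of the lattice `ℤ v ⊕ ℤ w`. -/
def latticeArea (v w : Plane) : ℝ := |v 0 * w 1 - v 1 * w 0|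

/-- `area(Γ)`. -/
def areaΓ (a : ℝ) : ℝ := latticeArea (v₁ a) (v₂ a)

/-- `area(𝓑)`: the Brillouin zone is a fundamental domain of the dual lattice. -/
def areaB (a : ℝ) : ℝ := latticeArea (k₁ a) (k₂ a)

/-! ### The space `L²_k(Γ)` and Fourier coefficients -/

lemma cell_subset (a : ℝ) : cell a ⊆
    (fun p : ℝ × ℝ => p.1 • v₁ a + p.2 • v₂ a) '' (Set.Icc 0 1 ×ˢ Set.Icc 0 1) :=
  Set.image_mono (Set.prod_mono Set.Ico_subset_Icc_self Set.Ico_subset_Icc_self)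

lemma volume_cell_lt_top (a : ℝ) : volume (cell a) < ⊤ :=
  lt_of_le_of_lt (measure_mono (cell_subset a))
    (((isCompact_Icc.prod isCompact_Icc).image (by fun_prop)).measure_lt_top)

instance (a : ℝ) : IsFiniteMeasure (volume.restrict (cell a)) :=
  ⟨by simpa using volume_cell_lt_top a⟩

/-- The Floquet condition `f(x + v) = e^{i k ⬝ v} f(x)` for almost every `x`. -/
def Floquet (k v : Plane) (f : Plane → ℂ) : Prop :=
  ∀ᵐ x : Plane, f (x + v) = Complex.exp (Complex.I * (inner ℝ k v : ℝ)) * f x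

lemma ae_shift (v : Plane) {p : Plane → Prop} (h : ∀ᵐ x : Plane, p x) :
    ∀ᵐ x : Plane, p (x + v) :=
  (measurePreserving_add_right (volume : Measure Plane) v).quasiMeasurePreserving.ae h

/-- The (classes of) functions on the plane which are square integrable over `Γ` and satisfy
`f(x + v_j) = e^{i k ⬝ v_j} f(x)` for `j = 1, 2`. -/
def floquetSubmodule (a : ℝ) (k : Plane) : Submodule ℂ (Plane →ₘ[volume] ℂ) where
  carrier := {f | Floquet k (v₁ a) f ∧ Floquet k (v₂ a) f ∧ MemLp f 2 (volume.restrict (cell a))}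
  add_mem' := by
    intro f g hf hg
    have key : ∀ v, Floquet k v f → Floquet k v g → Floquet k v (f + g : Plane →ₘ[volume] ℂ) := by
      intro v h1 h2
      filter_upwards [h1, h2, AEEqFun.coeFn_add f g, ae_shift v (AEEqFun.coeFn_add f g)]
        with x e1 e2 e3 e4
      rw [e3, e4, Pi.add_apply, Pi.add_apply, e1, e2, mul_add]
    exact ⟨key _ hf.1 hg.1, key _ hf.2.1 hg.2.1,
      (hf.2.2.add hg.2.2).ae_eq (ae_restrict_of_ae (AEEqFun.coeFn_add f g).symm)⟩
  zero_mem' := by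
    have h0 := AEEqFun.coeFn_zero (α := Plane) (β := ℂ) (μ := volume)
    have key : ∀ v, Floquet k v (0 : Plane →ₘ[volume] ℂ) := by
      intro v
      filter_upwards [h0, ae_shift v h0] with x e1 e2
      rw [e1, e2]; simp
    exact ⟨key _, key _, MemLp.zero.ae_eq (ae_restrict_of_ae h0.symm)⟩
  smul_mem' := by
    intro c f hf
    have key : ∀ v, Floquet k v f → Floquet k v (c • f : Plane →ₘ[volume] ℂ) := by
      intro v h1
      filter_upwards [h1, AEEqFun.coeFn_smul c f, ae_shift v (AEEqFun.coeFn_smul c f)]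
        with x e1 e3 e4
      rw [e3, e4, Pi.smul_apply, Pi.smul_apply, e1, smul_eq_mul, smul_eq_mul]; ring
    exact ⟨key _ hf.1, key _ hf.2.1,
      (hf.2.2.const_smul c).ae_eq (ae_restrict_of_ae (AEEqFun.coeFn_smul c f).symm)⟩

/-- The space `L²_k(Γ)`. -/
def L2k (a : ℝ) (k : Plane) : Type := floquetSubmodule a k

instance (a : ℝ) (k : Plane) : AddCommGroup (L2k a k) :=
  inferInstanceAs (AddCommGroup (floquetSubmodule a k))

instance (a : ℝ) (k : Plane) : Module ℂ (L2k a k) :=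
  inferInstanceAs (Module ℂ (floquetSubmodule a k))

/-- The inclusion of `L²_k(Γ)` into the space of classes of measurable functions on the plane. -/
def L2k.incl (a : ℝ) (k : Plane) : L2k a k →ₗ[ℂ] (Plane →ₘ[volume] ℂ) :=
  (floquetSubmodule a k).subtype

/-- The plane wave `x ↦ e^{i (ξ_m + k) ⬝ x}`. -/
def planeWave (a : ℝ) (k : Plane) (m : ℤ × ℤ) (x : Plane) : ℂ :=
  Complex.exp (Complex.I * (inner ℝ (dualVec a m + k) x : ℝ))

lemma integrable_planeWave_mul (a : ℝ) (k : Plane) (m : ℤ × ℤ) (f : L2k a k) :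
    Integrable (fun x => starRingEnd ℂ (planeWave a k m x) * L2k.incl a k f x)
      (volume.restrict (cell a)) := by
  have hf : Integrable (L2k.incl a k f) (volume.restrict (cell a)) :=
    f.2.2.2.integrable (by norm_num)
  refine hf.bdd_mul (c := 1) ?_ ?_
  · apply Continuous.aestronglyMeasurable
    have h : Continuous fun x : Plane => (inner ℝ (dualVec a m + k) x : ℝ) :=
      Continuous.inner continuous_const continuous_id
    unfold planeWave
    fun_prop
  · refine Eventually.of_forall fun x => ?_
    rw [RCLike.norm_conj, planeWave, mul_comm, Complex.norm_exp_ofReal_mul_I]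

/-- The Fourier coefficients on `Γ`, normalised so that `f ↦ (f̂(ξ_m + k))_m` is the unitary
Fourier transform from `L²_k(Γ)` onto `ℓ²(Λ*)`. -/
def fourierCoeff (a : ℝ) (k : Plane) (m : ℤ × ℤ) : L2k a k →ₗ[ℂ] ℂ where
  toFun f := ((√(areaΓ a) : ℝ) : ℂ)⁻¹ *
    ∫ x in cell a, starRingEnd ℂ (planeWave a k m x) * L2k.incl a k f x
  map_add' f g := by
    rw [← mul_add, ← integral_add (integrable_planeWave_mul a k m f)
      (integrable_planeWave_mul a k m g)]
    congr 1
    refine integral_congr_ae (ae_restrict_of_ae ?_)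
    filter_upwards [AEEqFun.coeFn_add (L2k.incl a k f) (L2k.incl a k g)] with x hx
    rw [map_add, hx, Pi.add_apply, mul_add]
  map_smul' c f := by
    rw [RingHom.id_apply, smul_eq_mul, mul_left_comm, ← integral_const_mul c]
    refine congrArg _ ?_
    refine integral_congr_ae (ae_restrict_of_ae ?_)
    filter_upwards [AEEqFun.coeFn_smul c (L2k.incl a k f)] with x hx
    rw [map_smul, hx, Pi.smul_apply, smul_eq_mul]; ring

/-! ### The point scatterer on the triangular lattice -/

/-- The eigenvalue `|ξ_m + k|²` of the free Floquet Laplacian `-Δ(k)` with eigenfunction the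
plane wave of index `m`. -/
def freeEigenvalue (a : ℝ) (k : Plane) (m : ℤ × ℤ) : ℝ := ‖dualVec a m + k‖ ^ 2

/-- The renormalised diagonal value of the Green function of `-Δ(k) - lam`:
`g_lam(0, k) = area(Γ)⁻¹ lim_{r → ∞} [∑_{|ξ_m + k| ≤ r} (|ξ_m + k|² - lam)⁻¹ - (2π / area(𝓑)) ln r]`.
-/
def greenDiag (a : ℝ) (k : Plane) (lam : ℝ) : ℝ :=
  (areaΓ a)⁻¹ * limUnder atTop (fun r : ℝ =>
    (∑ᶠ m ∈ {m : ℤ × ℤ | ‖dualVec a m + k‖ ≤ r}, (freeEigenvalue a k m - lam)⁻¹)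
      - 2 * Real.pi / areaB a * Real.log r)

/-- `Γ_{α,{0}}(lam, k) = α - g_lam(0, k)`. -/
def kreinGamma (a α : ℝ) (k : Plane) (lam : ℝ) : ℝ := α - greenDiag a k lam

/-- The function `F_lam(k, ξ_m) = (|ξ_m + k|² - lam)⁻¹` on the dual lattice. -/
def defect (a : ℝ) (k : Plane) (lam : ℝ) (m : ℤ × ℤ) : ℂ :=
  (((freeEigenvalue a k m - lam)⁻¹ : ℝ) : ℂ)

/-- The relation `ψ = (-Δ_{α,{0}}(k) - lam)⁻¹ h` in `L²_k(Γ)`, for real `lam` outside the free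
spectrum and with `Γ_{α,{0}}(lam, k) ≠ 0`, given by Krein's formula in Fourier space:
`ψ̂ = G_lam(k) ĥ + area(Γ)⁻¹ Γ_{α,{0}}(lam, k)⁻¹ (F_lam, ĥ) F_lam`,
where `G_lam(k)` is multiplication by `(|ξ_m + k|² - lam)⁻¹`. -/
def IsResolvent (a α : ℝ) (k : Plane) (lam : ℝ) (h ψ : L2k a k) : Prop :=
  ∃ s : ℂ, HasSum (fun m => starRingEnd ℂ (defect a k lam m) * fourierCoeff a k m h) s ∧
    ∀ m, fourierCoeff a k m ψ =
      (((freeEigenvalue a k m - lam)⁻¹ : ℝ) : ℂ) * fourierCoeff a k m h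
        + ((areaΓ a)⁻¹ : ℝ) * ((kreinGamma a α k lam)⁻¹ : ℝ) * s * defect a k lam m

/-- The graph of `-Δ_{α,{0}}(k)`: the pairs `(ψ, η)` such that `ψ` is the image of `η - lam ψ` under
the resolvent at `lam`, for every admissible real `lam`. -/
def scattererGraph (a α : ℝ) (k : Plane) : Submodule ℂ (L2k a k × L2k a k) where
  carrier := {p | ∀ lam : ℝ, (∀ m, freeEigenvalue a k m ≠ lam) → kreinGamma a α k lam ≠ 0 →
    IsResolvent a α k lam (p.2 - (lam : ℂ) • p.1) p.1}
  add_mem' := by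
    intro p q hp hq lam h1 h2
    obtain ⟨s, hs, hs'⟩ := hp lam h1 h2
    obtain ⟨t, ht, ht'⟩ := hq lam h1 h2
    refine ⟨s + t, ?_, fun m => ?_⟩
    · convert hs.add ht using 2 with m
      simp only [Prod.fst_add, Prod.snd_add, map_sub, map_add, map_smul, smul_eq_mul]
      ring
    · rw [Prod.fst_add, map_add, hs' m, ht' m]
      simp only [Prod.snd_add, map_sub, map_add, map_smul, smul_eq_mul]
      ring
  zero_mem' := by
    intro lam _ _
    exact ⟨0, by simp, fun m => by simp⟩
  smul_mem' := by
    intro c p hp lam h1 h2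
    obtain ⟨s, hs, hs'⟩ := hp lam h1 h2
    refine ⟨c * s, ?_, fun m => ?_⟩
    · have e : ∀ m, starRingEnd ℂ (defect a k lam m) *
          fourierCoeff a k m ((c • p).2 - (lam : ℂ) • (c • p).1) =
          c * (starRingEnd ℂ (defect a k lam m) *
            fourierCoeff a k m (p.2 - (lam : ℂ) • p.1)) := fun m => by
        simp only [Prod.smul_fst, Prod.smul_snd, map_sub, map_smul, smul_eq_mul]
        ring
      simp only [e]
      exact hs.mul_left c
    · rw [Prod.smul_fst, map_smul, hs' m]
      simp only [Prod.smul_snd, map_sub, map_smul, smul_eq_mul]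
      ring

/-- The unbounded operator `-Δ_{α,{0}}(k)` in `L²_k(Γ)`. -/
def scatterer (a α : ℝ) (k : Plane) : L2k a k →ₗ.[ℂ] L2k a k :=
  (scattererGraph a α k).toLinearPMap

/-! ### Eigenvalues of unbounded operators, counted with multiplicity -/

section Eigenvalues

variable {H : Type*} [AddCommGroup H] [Module ℂ H]

/-- The eigenspace `{ψ ∈ D(A) : A ψ = lam ψ}`. -/
def eigenspace (A : H →ₗ.[ℂ] H) (lam : ℝ) : Submodule ℂ H :=
  A.graph.comap (LinearMap.id.prod ((lam : ℂ) • LinearMap.id))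

/-- The number of eigenvalues in `S`, counted with multiplicity. -/
def eigenvalueCount (A : H →ₗ.[ℂ] H) (S : Set ℝ) : Cardinal :=
  Module.rank ℂ (⨆ lam ∈ S, eigenspace A lam : Submodule ℂ H)

/-- The `n`-th smallest eigenvalue of `A` counted with multiplicity, `n = 1, 2, …`. -/
def nthEigenvalue (A : H →ₗ.[ℂ] H) (n : ℕ) : ℝ :=
  sInf {μ : ℝ | (n : Cardinal) ≤ eigenvalueCount A (Set.Iic μ)}

/-- `μ` is the `n`-th smallest eigenvalue of `A`: fewer than `n` eigenvalues are smaller than `μ`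
and at least `n` are at most `μ`, counted with multiplicity. -/
def IsNthEigenvalue (A : H →ₗ.[ℂ] H) (n : ℕ) (μ : ℝ) : Prop :=
  eigenvalueCount A (Set.Iio μ) < (n : Cardinal) ∧ (n : Cardinal) ≤ eigenvalueCount A (Set.Iic μ)

end Eigenvalues

/-- The dispersion band function `ν_n(k, α)`, `n = 1, 2, …`. -/
def bandFunction (a α : ℝ) (n : ℕ) (k : Plane) : ℝ := nthEigenvalue (scatterer a α k) n

end PointScatterer

end

/-! By Krein's formula an eigenvector for `mu` satisfies `(E_m - mu) ψ̂_m = const`, where `E_m =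
|ξ_m + k|²`. If `mu` is not a free eigenvalue, then `ψ̂_m` is proportional to `1 / (E_m - mu)`, and
this is an eigenvector exactly when `g_mu(0, k) = α`; such eigenvalues are simple. If `mu` is a free
eigenvalue of multiplicity `N`, the constant vanishes and the eigenspace consists of the free
eigenfunctions whose coefficients sum to zero, so its dimension is `N - 1`
(`rank_eigenspace_eq_one`, `rank_eigenspace_free`).

At `K` exactly three points `ξ_m + K` have length `|K|`, and all others have length at least `2|K|`.
For `k` near `K` the three free eigenvalues are `c + d_j` with `c = |K|² + |k - K|²` and `d_j = 2
(ξ_j + K) · (k - K)`. The three vectors form an equilateral triangle centred at `0`, hence `∑ d_j =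
0` and `∑ d_j² = 6 s²` with `s = |K| |k - K|`, whatever the direction of `k - K`.

Below `2|K|²` the equation `g = α` reads `∑ 1 / (E_j - x) + R(x) = 0` with `R` continuous,
increasing and bounded uniformly in `k` on `[0, 2|K|²]` (`secular_eq`, `exists_abs_remainder_le`).
Monotonicity between poles yields one zero below the lowest pole and one in each nondegenerate gap;
where two poles coincide, the pole itself replaces the missing zero. So the second and third
eigenvalues lie in the two closed gaps (`exists_isNthEigenvalue`). With `x = c + t`, clearing
denominators gives `3 (t² - s²) = -R ∏ (d_j - t) = O(s³)`, whence `t = ∓ s + O(s²)`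
(`first_zero_near`, `second_zero_near`). The slope is `|K| = 4π / (3a)`. -/

namespace PointScatterer

/-! ### Coordinates adapted to a lattice -/

/-- The matrix whose rows are `u / 2π` and `w / 2π`. -/
noncomputable def coordMatrix (u w : Plane) : Matrix (Fin 2) (Fin 2) ℝ :=
  !![u 0 / (2 * Real.pi), u 1 / (2 * Real.pi); w 0 / (2 * Real.pi), w 1 / (2 * Real.pi)]

/-- The coordinates of a point of the plane in the basis dual to `u / 2π, w / 2π`. -/
noncomputable def coords (u w : Plane) (x : Plane) : Fin 2 → ℝ :=
  Matrix.toLin' (coordMatrix u w) (WithLp.ofLp x)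

lemma coords_zero (u w x : Plane) : coords u w x 0 = inner ℝ u x / (2 * Real.pi) := by
  simp [coords, coordMatrix, Matrix.mulVec, dotProduct, Fin.sum_univ_two, PiLp.inner_apply]
  ring

lemma coords_one (u w x : Plane) : coords u w x 1 = inner ℝ w x / (2 * Real.pi) := by
  simp [coords, coordMatrix, Matrix.mulVec, dotProduct, Fin.sum_univ_two, PiLp.inner_apply]
  ring

lemma coords_add (u w x y : Plane) : coords u w (x + y) = coords u w x + coords u w y := by
  rw [coords, WithLp.ofLp_add, map_add]
  rfl

lemma coords_sub (u w x y : Plane) : coords u w (x - y) = coords u w x - coords u w y := by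
  simp [coords, Matrix.mulVec_sub]

lemma coords_smul (u w : Plane) (s : ℝ) (x : Plane) : coords u w (s • x) = s • coords u w x := by
  simp [coords]

lemma continuous_coords (u w : Plane) : Continuous (coords u w) := by
  unfold coords
  exact (LinearMap.continuous_of_finiteDimensional _).comp (PiLp.continuous_ofLp 2 _)

/-- `e, f` and `u, w` generate dual lattices (with the factor `2π`). -/
structure DualPair (u w e f : Plane) : Prop where
  ue : inner ℝ u e = 2 * Real.pi
  uf : inner ℝ u f = 0
  we : inner ℝ w e = 0
  wf : inner ℝ w f = 2 * Real.pi

lemma latticeArea_nonneg (v w : Plane) : 0 ≤ latticeArea v w := abs_nonneg _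

lemma abs_det_coordMatrix (u w : Plane) :
    |(coordMatrix u w).det| = latticeArea u w / (4 * Real.pi ^ 2) := by
  have h : (coordMatrix u w).det = (u 0 * w 1 - u 1 * w 0) / (4 * Real.pi ^ 2) := by
    have := Real.pi_pos
    simp only [coordMatrix, Matrix.det_fin_two_of]
    field_simp
    ring
  rw [h, abs_div, latticeArea, abs_of_pos (by positivity : 0 < 4 * Real.pi ^ 2)]

namespace DualPair

variable {u w e f : Plane} (h : DualPair u w e f)
include h

lemma symm : DualPair e f u w where
  ue := by rw [real_inner_comm]; exact h.ue
  uf := by rw [real_inner_comm]; exact h.we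
  we := by rw [real_inner_comm]; exact h.uf
  wf := by rw [real_inner_comm]; exact h.wf

/-- The product of the two determinants is the determinant of the Gram matrix of `u, w` against `e,
f`, which is `2π` times the identity. -/
lemma area_mul : latticeArea u w * latticeArea e f = 4 * Real.pi ^ 2 := by
  have h1 := h.ue
  have h2 := h.uf
  have h3 := h.we
  have h4 := h.wf
  simp only [PiLp.inner_apply, Fin.sum_univ_two, RCLike.inner_apply, conj_trivial] at h1 h2 h3 h4
  rw [latticeArea, latticeArea, ← abs_mul]
  have : (u 0 * w 1 - u 1 * w 0) * (e 0 * f 1 - e 1 * f 0) = 4 * Real.pi ^ 2 := by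
    calc _ = (e 0 * u 0 + e 1 * u 1) * (f 0 * w 0 + f 1 * w 1)
        - (f 0 * u 0 + f 1 * u 1) * (e 0 * w 0 + e 1 * w 1) := by ring
      _ = _ := by rw [h1, h2, h3, h4]; ring
  rw [this, abs_of_nonneg (by positivity)]

lemma area_pos : 0 < latticeArea e f := by
  have h1 := h.area_mul
  have h2 : 0 < 4 * Real.pi ^ 2 := by positivity
  rcases (latticeArea_nonneg e f).eq_or_lt with h0 | h0
  · rw [← h0, mul_zero] at h1
    linarith
  · exact h0

lemma det_ne_zero : (coordMatrix u w).det ≠ 0 := by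
  intro h0
  have h1 := abs_det_coordMatrix u w
  have h2 := h.symm.area_pos
  rw [h0, abs_zero] at h1
  have : 0 < latticeArea u w / (4 * Real.pi ^ 2) := by positivity
  linarith

lemma coords_left : coords u w e = Pi.single 0 1 := by
  ext i
  have := Real.pi_pos
  fin_cases i
  · simp [coords_zero, h.ue]
  · simp [coords_one, h.we]

lemma coords_right : coords u w f = Pi.single 1 1 := by
  ext i
  have := Real.pi_pos
  fin_cases i
  · simp [coords_zero, h.uf]
  · simp [coords_one, h.wf]

lemma coords_comb (s t : ℝ) : coords u w (s • e + t • f) = ![s, t] := by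
  rw [coords_add, coords_smul, coords_smul, h.coords_left, h.coords_right]
  ext i
  fin_cases i <;> simp

lemma coords_injective : Function.Injective (coords u w) := by
  have h1 : Function.Injective (Matrix.mulVec (coordMatrix u w)) :=
    Matrix.mulVec_injective_iff_isUnit.mpr
      ((Matrix.isUnit_iff_isUnit_det _).mpr (isUnit_iff_ne_zero.mpr h.det_ne_zero))
  intro x y hxy
  apply WithLp.ofLp_injective
  exact h1 (by simpa [coords] using hxy)

lemma comb_coords (x : Plane) : coords u w x 0 • e + coords u w x 1 • f = x := by
  apply h.coords_injective
  rw [h.coords_comb]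
  ext i
  fin_cases i <;> simp

lemma measurableEmbedding_coords : MeasurableEmbedding (coords u w) :=
  (continuous_coords u w).measurableEmbedding h.coords_injective

/-- The density is the inverse of the determinant of the coordinate map, which by `area_mul` is the
covolume of the lattice spanned by `e, f`. -/
lemma measurePreserving_coords :
    MeasurePreserving (coords u w) volume (ENNReal.ofReal (latticeArea e f) • volume) := by
  refine ⟨(continuous_coords u w).measurable, ?_⟩
  have h1 := Real.map_matrix_volume_pi_eq_smul_volume_pi h.det_ne_zero
  have h2 : |(coordMatrix u w).det⁻¹| = latticeArea e f := by
    rw [abs_inv, abs_det_coordMatrix]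
    have := h.area_mul
    have h3 := h.symm.area_pos
    rw [inv_div, ← this]
    field_simp
  rw [h2] at h1
  rw [← h1, ← (PiLp.volume_preserving_ofLp (Fin 2)).map_eq, Measure.map_map]
  · rfl
  · exact (LinearMap.continuous_of_finiteDimensional _).measurable
  · exact (PiLp.continuous_ofLp 2 _).measurable

end DualPair

/-! ### The triangular lattice -/

lemma dualPair_k_v {a : ℝ} (ha : 0 < a) : DualPair (k₁ a) (k₂ a) (v₁ a) (v₂ a) := by
  have h3 : √3 * √3 = 3 := Real.mul_self_sqrt (by norm_num)
  have h3' : (√3) ^ 2 = 3 := Real.sq_sqrt (by norm_num)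
  have h0 : 0 < √3 := by positivity
  constructor <;>
  · simp [k₁, k₂, v₁, v₂, PiLp.inner_apply, Fin.sum_univ_two]
    field_simp
    nlinarith

lemma dualPair_v_k {a : ℝ} (ha : 0 < a) : DualPair (v₁ a) (v₂ a) (k₁ a) (k₂ a) :=
  (dualPair_k_v ha).symm

lemma areaΓ_pos {a : ℝ} (ha : 0 < a) : 0 < areaΓ a := (dualPair_k_v ha).area_pos

lemma areaB_pos {a : ℝ} (ha : 0 < a) : 0 < areaB a := (dualPair_v_k ha).area_pos

lemma cell_eq {a : ℝ} (ha : 0 < a) :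
    cell a = coords (k₁ a) (k₂ a) ⁻¹' {y | ∀ i, y i ∈ Set.Ico (0 : ℝ) 1} := by
  have h := dualPair_k_v ha
  ext x
  simp only [cell, Set.mem_image, Set.mem_prod, Prod.exists, Set.mem_preimage, Set.mem_ofPred_eq,
    Fin.forall_fin_two]
  constructor
  · rintro ⟨s, t, ⟨hs, ht⟩, rfl⟩
    rw [h.coords_comb]
    exact ⟨hs, ht⟩
  · intro hx
    exact ⟨_, _, hx, h.comb_coords x⟩

lemma inner_dualVec (a : ℝ) (m : ℤ × ℤ) (x : Plane) :
    inner ℝ (dualVec a m) x = 2 * Real.pi *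
      (m.1 * coords (k₁ a) (k₂ a) x 0 + m.2 * coords (k₁ a) (k₂ a) x 1) := by
  have := Real.pi_pos
  rw [dualVec, inner_add_left, real_inner_smul_left, real_inner_smul_left, coords_zero, coords_one]
  field_simp

/-- The squared norm of `s k₁ + t k₂`. -/
lemma norm_sq_comb {a : ℝ} (ha : 0 < a) (s t : ℝ) :
    ‖s • k₁ a + t • k₂ a‖ ^ 2 = 16 * Real.pi ^ 2 / (3 * a ^ 2) * (s ^ 2 + t ^ 2 - s * t) := by
  have h3 : (√3) ^ 2 = 3 := Real.sq_sqrt (by norm_num)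
  have h0 : 0 < √3 := by positivity
  rw [EuclideanSpace.norm_sq_eq]
  simp [k₁, k₂, Fin.sum_univ_two]
  field_simp
  rw [h3]
  ring

/-! ### Fourier series on `L²_k(Γ)` -/

section Torus

attribute [local instance] instMeasureSpaceUnitAddCircle

/-- The half-open square `(0, 1]²`. -/
def unitBox : Set (Fin 2 → ℝ) := {y | ∀ i, y i ∈ Set.Ioc ((0 : Fin 2 → ℝ) i) ((0 : Fin 2 → ℝ) i + 1)}

lemma measurableSet_unitBox : MeasurableSet unitBox :=
  MeasurableSet.univ_pi' fun _ => measurableSet_Ioc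

lemma measurePreserving_toTorus :
    MeasurePreserving (fun (y : Fin 2 → ℝ) i => (y i : UnitAddCircle))
      (volume.restrict unitBox) (volume : Measure (UnitAddTorus (Fin 2))) := by
  have h1 := (UnitAddTorus.measurePreserving_equivPiIoc (d := Fin 2) 0).symm
  have hm : Measurable (fun (y : Fin 2 → ℝ) i => (y i : UnitAddCircle)) :=
    measurable_pi_lambda _ fun i => AddCircle.measurable_mk'.comp (measurable_pi_apply i)
  refine ⟨hm, ?_⟩
  rw [← map_comap_subtype_coe measurableSet_unitBox, Measure.map_map hm measurable_subtype_coe]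
  exact h1.map_eq

variable {a : ℝ} (k : Plane)

/-- The point of the torus with the same lattice coordinates. -/
noncomputable def torusPoint (a : ℝ) (x : Plane) : UnitAddTorus (Fin 2) :=
  fun i => (coords (k₁ a) (k₂ a) x i : UnitAddCircle)

/-- The representative of a point of the torus in the fundamental cell. -/
noncomputable def torusSection (a : ℝ) (t : UnitAddTorus (Fin 2)) : Plane :=
  (UnitAddTorus.measurableEquivPiIoc 0 t).1 0 • v₁ a +
    (UnitAddTorus.measurableEquivPiIoc 0 t).1 1 • v₂ a

lemma measurable_torusPoint (a : ℝ) : Measurable (torusPoint a) :=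
  measurable_pi_lambda _ fun i => AddCircle.measurable_mk'.comp
    ((measurable_pi_apply i).comp (continuous_coords _ _).measurable)

lemma measurable_torusSection (a : ℝ) : Measurable (torusSection a) := by
  have h : Measurable fun t : UnitAddTorus (Fin 2) => (UnitAddTorus.measurableEquivPiIoc 0 t).1 :=
    measurable_subtype_coe.comp (UnitAddTorus.measurableEquivPiIoc 0).measurable
  exact (((measurable_pi_apply 0).comp h).smul_const _).add
    (((measurable_pi_apply 1).comp h).smul_const _)

/-- The cell is `[0, 1)²` in lattice coordinates, while the section of the torus takes values in
`(0, 1]²`; the two boxes differ by a null set. -/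
lemma restrict_cell (ha : 0 < a) : (volume.restrict (cell a) : Measure Plane) =
    volume.restrict (coords (k₁ a) (k₂ a) ⁻¹' unitBox) := by
  rw [cell_eq ha]
  apply Measure.restrict_congr_set
  have h : ({y | ∀ i, y i ∈ Set.Ico (0 : ℝ) 1} : Set (Fin 2 → ℝ)) =ᵐ[volume] unitBox := by
    have e1 := Measure.univ_pi_Ico_ae_eq_Icc (μ := fun _ : Fin 2 => (volume : Measure ℝ))
      (f := 0) (g := 1)
    have e2 := Measure.univ_pi_Ioc_ae_eq_Icc (μ := fun _ : Fin 2 => (volume : Measure ℝ))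
      (f := 0) (g := 1)
    have a1 : {y | ∀ i, y i ∈ Set.Ico (0 : ℝ) 1} =
        Set.univ.pi fun i => Set.Ico ((0 : Fin 2 → ℝ) i) ((1 : Fin 2 → ℝ) i) := by
      ext y; simp
    have a2 : unitBox = Set.univ.pi fun i => Set.Ioc ((0 : Fin 2 → ℝ) i) ((1 : Fin 2 → ℝ) i) := by
      ext y; simp [unitBox]
    rw [a1, a2]
    exact e1.trans e2.symm
  have hq := (dualPair_k_v ha).measurePreserving_coords
  apply hq.quasiMeasurePreserving.preimage_ae_eq
  exact Measure.smul_absolutelyContinuous.ae_eq h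

lemma measurePreserving_torusPoint (ha : 0 < a) :
    MeasurePreserving (torusPoint a) (volume.restrict (cell a))
      (ENNReal.ofReal (areaΓ a) • volume) := by
  rw [restrict_cell ha]
  have h := dualPair_k_v ha
  have h1 := h.measurePreserving_coords.restrict_preimage_emb h.measurableEmbedding_coords unitBox
  rw [Measure.restrict_smul] at h1
  exact (measurePreserving_toTorus.smul_measure (ENNReal.ofReal (areaΓ a))).comp h1

lemma ae_torusSection_torusPoint (ha : 0 < a) :
    ∀ᵐ x ∂(volume.restrict (cell a)), torusSection a (torusPoint a x) = x := by
  rw [restrict_cell ha]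
  refine (ae_restrict_mem
    ((continuous_coords _ _).measurable measurableSet_unitBox)).mono fun x hx => ?_
  have e : UnitAddTorus.measurableEquivPiIoc 0 (torusPoint a x) =
      ⟨coords (k₁ a) (k₂ a) x, hx⟩ := by
    rw [← MeasurableEquiv.eq_symm_apply]
    rfl
  rw [torusSection, e]
  exact (dualPair_k_v ha).comb_coords x

lemma measurePreserving_torusSection (ha : 0 < a) :
    MeasurePreserving (torusSection a) (ENNReal.ofReal (areaΓ a) • volume)
      (volume.restrict (cell a)) := by
  refine ⟨measurable_torusSection a, ?_⟩
  have h := measurePreserving_torusPoint ha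
  rw [← h.map_eq, Measure.map_map (measurable_torusSection a) h.measurable]
  exact (Measure.map_congr (ae_torusSection_torusPoint ha)).trans Measure.map_id

/-- The periodic part of a function, read on the torus. -/
noncomputable def periodicPart (f : L2k a k) (t : UnitAddTorus (Fin 2)) : ℂ :=
  Complex.exp (-(Complex.I * (inner ℝ k (torusSection a t) : ℝ))) *
    L2k.incl a k f (torusSection a t)

lemma continuous_phase (c : ℂ) :
    Continuous fun x : Plane => Complex.exp (c * (Complex.I * (inner ℝ k x : ℝ))) := by
  have h : Continuous fun x : Plane => (inner ℝ k x : ℝ) :=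
    Continuous.inner continuous_const continuous_id
  fun_prop

lemma norm_phase (x : Plane) : ‖Complex.exp (Complex.I * (inner ℝ k x : ℝ))‖ = 1 := by
  rw [mul_comm, Complex.norm_exp_ofReal_mul_I]

lemma norm_phase_neg (x : Plane) : ‖Complex.exp (-(Complex.I * (inner ℝ k x : ℝ)))‖ = 1 := by
  rw [Complex.exp_neg, norm_inv, norm_phase, inv_one]

variable {k}

lemma memLp_periodicPart (ha : 0 < a) (f : L2k a k) :
    MemLp (periodicPart k f) 2 (volume : Measure (UnitAddTorus (Fin 2))) := by
  have h1 : MemLp (fun x => Complex.exp (-(Complex.I * (inner ℝ k x : ℝ))) *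
      L2k.incl a k f x) 2 (volume.restrict (cell a)) := by
    have h0 : MemLp (L2k.incl a k f) 2 (volume.restrict (cell a)) := f.2.2.2
    refine h0.of_le ?_ (Eventually.of_forall fun x => ?_)
    · refine AEStronglyMeasurable.mul ?_ h0.1
      simpa using (continuous_phase k (-1)).aestronglyMeasurable
    · rw [norm_mul, norm_phase_neg, one_mul]
  have h2 := h1.comp_measurePreserving (measurePreserving_torusSection ha)
  have h3 := h2.smul_measure (c := (ENNReal.ofReal (areaΓ a))⁻¹)
    (ENNReal.inv_ne_top.mpr (by simpa using areaΓ_pos ha))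
  rwa [smul_smul, ENNReal.inv_mul_cancel (by simpa using areaΓ_pos ha) ENNReal.ofReal_ne_top,
    one_smul] at h3

lemma planeWave_eq (a : ℝ) (k : Plane) (m : ℤ × ℤ) (x : Plane) :
    planeWave a k m x = UnitAddTorus.mFourier ![m.1, m.2] (torusPoint a x) *
      Complex.exp (Complex.I * (inner ℝ k x : ℝ)) := by
  simp only [planeWave, UnitAddTorus.mFourier, ContinuousMap.coe_mk, torusPoint, Fin.prod_univ_two,
    fourier_coe_apply, ← Complex.exp_add, inner_add_left, inner_dualVec]
  congr 1
  simp
  ring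

lemma conj_planeWave (a : ℝ) (k : Plane) (m : ℤ × ℤ) (x : Plane) :
    starRingEnd ℂ (planeWave a k m x) = UnitAddTorus.mFourier (-![m.1, m.2]) (torusPoint a x) *
      Complex.exp (-(Complex.I * (inner ℝ k x : ℝ))) := by
  rw [planeWave_eq, map_mul, UnitAddTorus.mFourier_neg, ← Complex.exp_conj]
  simp

lemma integral_cell_torus (ha : 0 < a) {F : UnitAddTorus (Fin 2) → ℂ}
    (hF : AEStronglyMeasurable F volume) :
    ∫ x in cell a, F (torusPoint a x) = (areaΓ a : ℂ) * ∫ t, F t := by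
  have h := measurePreserving_torusPoint ha
  have hF' : AEStronglyMeasurable F (Measure.map (torusPoint a) (volume.restrict (cell a))) := by
    rw [h.map_eq]
    exact hF.smul_measure _
  rw [← integral_map h.measurable.aemeasurable hF', h.map_eq, integral_smul_measure,
    ENNReal.toReal_ofReal (areaΓ_pos ha).le]
  simp

lemma fourierCoeff_eq (ha : 0 < a) (f : L2k a k) (m : ℤ × ℤ) :
    fourierCoeff a k m f =
      (√(areaΓ a) : ℝ) * UnitAddTorus.mFourierCoeff (periodicPart k f) ![m.1, m.2] := by
  have h1 : ∫ x in cell a, starRingEnd ℂ (planeWave a k m x) * L2k.incl a k f x =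
      ∫ x in cell a, (fun t => UnitAddTorus.mFourier (-![m.1, m.2]) t • periodicPart k f t)
        (torusPoint a x) := by
    refine integral_congr_ae ?_
    filter_upwards [ae_torusSection_torusPoint ha] with x hx
    simp only [periodicPart, hx, conj_planeWave, smul_eq_mul, mul_assoc]
  have h2 : ((√(areaΓ a) : ℝ) : ℂ) ≠ 0 := by
    have := areaΓ_pos ha
    simp only [ne_eq, Complex.ofReal_eq_zero]
    positivity
  have h3 : (areaΓ a : ℂ) = ((√(areaΓ a) : ℝ) : ℂ) * ((√(areaΓ a) : ℝ) : ℂ) := by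
    rw [← Complex.ofReal_mul, Real.mul_self_sqrt (areaΓ_pos ha).le]
  change ((√(areaΓ a) : ℝ) : ℂ)⁻¹ *
    ∫ x in cell a, starRingEnd ℂ (planeWave a k m x) * L2k.incl a k f x = _
  rw [h1, integral_cell_torus ha (F := fun t =>
    UnitAddTorus.mFourier (-![m.1, m.2]) t • periodicPart k f t), h3, mul_assoc,
    inv_mul_cancel_left₀ h2]
  · rfl
  · exact (UnitAddTorus.mFourier _).continuous.aestronglyMeasurable.smul (memLp_periodicPart ha f).1

/-- Bessel's inequality, in the form of square summability of the Fourier coefficients. -/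
lemma summable_fourierCoeff (ha : 0 < a) (f : L2k a k) :
    Summable fun m => ‖fourierCoeff a k m f‖ ^ 2 := by
  have h0 := memLp_periodicPart ha f
  have h1 := (UnitAddTorus.hasSum_sq_mFourierCoeff (h0.toLp _)).summable
  have h2 : ∀ n, UnitAddTorus.mFourierCoeff (h0.toLp _) n =
      UnitAddTorus.mFourierCoeff (periodicPart k f) n := fun n =>
    integral_congr_ae (h0.coeFn_toLp.mono fun t ht => by simp only [ht])
  simp only [h2] at h1
  have h3 := ((finTwoArrowEquiv ℤ).symm.summable_iff.mpr h1).mul_left (areaΓ a)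
  refine h3.congr fun m => ?_
  rw [fourierCoeff_eq ha, norm_mul, mul_pow, Complex.norm_real, Real.norm_eq_abs, sq_abs,
    Real.sq_sqrt (areaΓ_pos ha).le]
  rfl

/-- The translations that preserve the zero set up to a null set form a subgroup. By the Floquet
conditions it contains `v₁` and `v₂`, hence the lattice, and countably many translates of the cell
cover the plane. -/
lemma ae_eq_zero_of_ae_cell (ha : 0 < a) (f : L2k a k)
    (h : ∀ᵐ x ∂(volume.restrict (cell a)), L2k.incl a k f x = 0) :
    ∀ᵐ x : Plane, L2k.incl a k f x = 0 := by
  let G : AddSubgroup Plane :=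
    { carrier := {v | ∀ᵐ x : Plane, L2k.incl a k f (x + v) = 0 ↔ L2k.incl a k f x = 0}
      zero_mem' := by simp
      add_mem' := by
        intro v w hv hw
        filter_upwards [hw, ae_shift w hv] with x h1 h2
        rw [← h1, ← h2, add_assoc, add_comm w v]
      neg_mem' := by
        intro v hv
        filter_upwards [ae_shift (-v) hv] with x h1
        rw [← h1, neg_add_cancel_right] }
  have key : ∀ v, Floquet k v (L2k.incl a k f) → v ∈ G := by
    intro v hv
    refine hv.mono fun x hx => ?_
    rw [hx]
    simp [Complex.exp_ne_zero]
  have hG : ∀ m : ℤ × ℤ, m.1 • v₁ a + m.2 • v₂ a ∈ G := fun m =>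
    G.add_mem (G.zsmul_mem (key _ f.2.1) _) (G.zsmul_mem (key _ f.2.2.1) _)
  have hc : MeasurableSet (cell a) := by
    rw [cell_eq ha]
    exact (continuous_coords _ _).measurable (MeasurableSet.univ_pi' fun _ => measurableSet_Ico)
  rw [ae_restrict_iff' hc] at h
  have h2 : ∀ m : ℤ × ℤ, ∀ᵐ x : Plane, x + (m.1 • v₁ a + m.2 • v₂ a) ∈ cell a →
      L2k.incl a k f x = 0 := by
    intro m
    filter_upwards [ae_shift _ h, hG m] with x h1 h2 h3
    exact h2.mp (h1 h3)
  filter_upwards [ae_all_iff.mpr h2] with x hx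
  have hd := dualPair_k_v ha
  refine hx (-⌊coords (k₁ a) (k₂ a) x 0⌋, -⌊coords (k₁ a) (k₂ a) x 1⌋) ?_
  rw [cell_eq ha, Set.mem_preimage, coords_add, ← Int.cast_smul_eq_zsmul ℝ,
    ← Int.cast_smul_eq_zsmul ℝ, hd.coords_comb]
  intro i
  fin_cases i
  · simpa [← sub_eq_add_neg] using Int.fract_lt_one (coords (k₁ a) (k₂ a) x 0)
  · simpa [← sub_eq_add_neg] using Int.fract_lt_one (coords (k₁ a) (k₂ a) x 1)

/-- Completeness of the plane waves in `L²_k(Γ)`. -/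
lemma eq_zero_of_fourierCoeff_eq_zero (ha : 0 < a) (f : L2k a k)
    (h : ∀ m, fourierCoeff a k m f = 0) : f = 0 := by
  have h0 := memLp_periodicPart ha f
  have hA := areaΓ_pos ha
  have h2 : ∀ n, UnitAddTorus.mFourierCoeff (h0.toLp _) n =
      UnitAddTorus.mFourierCoeff (periodicPart k f) n := fun n =>
    integral_congr_ae (h0.coeFn_toLp.mono fun t ht => by simp only [ht])
  have h3 : ∀ n, UnitAddTorus.mFourierCoeff (periodicPart k f) n = 0 := by
    intro n
    have h4 := h (n 0, n 1)
    rw [fourierCoeff_eq ha, mul_eq_zero] at h4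
    rcases h4 with h4 | h4
    · rw [Complex.ofReal_eq_zero, Real.sqrt_eq_zero hA.le] at h4
      exact absurd h4 hA.ne'
    · convert h4 using 2
      ext i
      fin_cases i <;> rfl
  have h5 : h0.toLp _ = 0 := by
    apply UnitAddTorus.mFourierBasis.repr.injective
    ext n
    rw [UnitAddTorus.mFourierBasis_repr, h2, h3]
    simp
  have h6 : periodicPart k f =ᵐ[volume] 0 := by
    have h7 := h0.coeFn_toLp
    rw [h5] at h7
    exact h7.symm.trans (Lp.coeFn_zero _ _ _)
  have h7 : ∀ᵐ x ∂(volume.restrict (cell a)), periodicPart k f (torusPoint a x) = 0 := by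
    exact (measurePreserving_torusPoint ha).quasiMeasurePreserving.ae
      (p := fun t => periodicPart k f t = 0) (Measure.ae_smul_measure h6 _)
  have h8 : ∀ᵐ x ∂(volume.restrict (cell a)), L2k.incl a k f x = 0 := by
    filter_upwards [h7, ae_torusSection_torusPoint ha] with x h9 h10
    simpa [periodicPart, h10, Complex.exp_ne_zero] using h9
  apply Subtype.ext
  apply AEEqFun.ext
  filter_upwards [ae_eq_zero_of_ae_cell ha f h8,
    AEEqFun.coeFn_zero (α := Plane) (β := ℂ) (μ := volume)] with x h9 h10
  exact h9.trans h10.symm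

/-- The Riesz–Fischer theorem for the plane waves in `L²_k(Γ)`. -/
lemma exists_fourierCoeff_eq (ha : 0 < a) (k : Plane) {c : ℤ × ℤ → ℂ}
    (hc : Summable fun m => ‖c m‖ ^ 2) : ∃ f : L2k a k, ∀ m, fourierCoeff a k m f = c m := by
  have hA := areaΓ_pos ha
  have hs : ((√(areaΓ a) : ℝ) : ℂ) ≠ 0 := by
    simp only [ne_eq, Complex.ofReal_eq_zero]
    positivity
  have hc' : Memℓp (fun n : Fin 2 → ℤ => c (n 0, n 1)) 2 := by
    apply memℓp_gen
    refine ((finTwoArrowEquiv ℤ).summable_iff.mpr hc).congr fun n => ?_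
    simp [finTwoArrowEquiv]
  obtain ⟨F, hF⟩ := UnitAddTorus.mFourierBasis.repr.surjective ⟨_, hc'⟩
  have hFc : ∀ m : ℤ × ℤ, UnitAddTorus.mFourierCoeff F ![m.1, m.2] = c m := by
    intro m
    rw [← UnitAddTorus.mFourierBasis_repr, hF]
    rfl
  have hFm := (Lp.stronglyMeasurable F).comp_measurable (measurable_torusPoint a)
  -- `torusPoint` is defined on the whole plane and is lattice periodic, so this product satisfies
  -- the Floquet condition at every point.
  let g : Plane → ℂ := fun x => ((√(areaΓ a) : ℝ) : ℂ)⁻¹ *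
    (Complex.exp (1 * (Complex.I * (inner ℝ k x : ℝ))) * F (torusPoint a x))
  have hg : AEStronglyMeasurable g volume :=
    ((((continuous_phase k 1).stronglyMeasurable).mul hFm).const_mul _).aestronglyMeasurable
  have hper : ∀ v : Plane, (∃ n : Fin 2 → ℤ, coords (k₁ a) (k₂ a) v = fun i => (n i : ℝ)) →
      Floquet k v g := by
    rintro v ⟨n, hn⟩
    refine Eventually.of_forall fun x => ?_
    have : torusPoint a (x + v) = torusPoint a x := by
      ext i
      simp only [torusPoint, coords_add, hn, Pi.add_apply, AddCircle.coe_add]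
      rw [add_eq_left, AddCircle.coe_eq_zero_iff]
      exact ⟨n i, by simp⟩
    simp only [g, this, one_mul, inner_add_right, Complex.ofReal_add, mul_add, Complex.exp_add]
    ring
  have hfl : ∀ v : Plane, Floquet k v g → Floquet k v (AEEqFun.mk g hg) := by
    intro v hv
    filter_upwards [hv, AEEqFun.coeFn_mk g hg, ae_shift v (AEEqFun.coeFn_mk g hg)] with x h1 h2 h3
    rw [h2, h3, h1]
  have hd := dualPair_k_v ha
  have hL : MemLp g 2 (volume.restrict (cell a)) := by
    have h1 := ((Lp.memLp F).smul_measure (c := ENNReal.ofReal (areaΓ a))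
      ENNReal.ofReal_ne_top).comp_measurePreserving (measurePreserving_torusPoint ha)
    refine MemLp.const_mul (h1.of_le ?_ (Eventually.of_forall fun x => ?_)) _
    · exact (((continuous_phase k 1).stronglyMeasurable).mul hFm).aestronglyMeasurable
    · simp only [one_mul, norm_mul, norm_phase, Function.comp_apply, le_refl]
  refine ⟨⟨AEEqFun.mk g hg, hfl _ (hper _ ⟨Pi.single 0 1, ?_⟩), hfl _ (hper _ ⟨Pi.single 1 1, ?_⟩),
    hL.ae_eq (ae_restrict_of_ae (AEEqFun.coeFn_mk g hg).symm)⟩, fun m => ?_⟩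
  · rw [hd.coords_left]
    ext i
    fin_cases i <;> simp
  · rw [hd.coords_right]
    ext i
    fin_cases i <;> simp
  · change ((√(areaΓ a) : ℝ) : ℂ)⁻¹ *
      ∫ x in cell a, starRingEnd ℂ (planeWave a k m x) * (AEEqFun.mk g hg : Plane →ₘ[volume] ℂ) x = _
    have h1 : ∫ x in cell a, starRingEnd ℂ (planeWave a k m x) *
        (AEEqFun.mk g hg : Plane →ₘ[volume] ℂ) x =
        ∫ x in cell a, (fun t => ((√(areaΓ a) : ℝ) : ℂ)⁻¹ *
          (UnitAddTorus.mFourier (-![m.1, m.2]) t • F t)) (torusPoint a x) := by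
      refine integral_congr_ae (ae_restrict_of_ae ?_)
      filter_upwards [AEEqFun.coeFn_mk g hg] with x hx
      rw [hx, conj_planeWave, Complex.exp_neg]
      simp only [g, one_mul, smul_eq_mul]
      field_simp [Complex.exp_ne_zero]
    rw [h1, integral_cell_torus ha (F := fun t => ((√(areaΓ a) : ℝ) : ℂ)⁻¹ *
          (UnitAddTorus.mFourier (-![m.1, m.2]) t • F t)), integral_const_mul, ← hFc m,
          UnitAddTorus.mFourierCoeff]
    · have h3 : (areaΓ a : ℂ) = ((√(areaΓ a) : ℝ) : ℂ) * ((√(areaΓ a) : ℝ) : ℂ) := by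
        rw [← Complex.ofReal_mul, Real.mul_self_sqrt hA.le]
      rw [h3]
      field_simp
    · exact ((UnitAddTorus.mFourier _).continuous.aestronglyMeasurable.smul (Lp.memLp F).1).const_mul _

end Torus

/-! ### Lattice sums -/

section LatticeSums

variable {a : ℝ}

/-- A summable majorant for sums over the dual lattice. -/
noncomputable def decay (a : ℝ) (m : ℤ × ℤ) : ℝ := ((1 + ‖dualVec a m‖) ^ 3)⁻¹

lemma decay_nonneg (a : ℝ) (m : ℤ × ℤ) : 0 ≤ decay a m := by
  unfold decay; positivity

/-- Since `s² + t² - s t ≥ (3/4) s²`, and likewise with `t²`, the hexagonal norm dominates the sup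
norm of the index. Lattice sums are thereby reduced to the convergence of `∑ ‖n‖⁻³` over `ℤ²`. -/
lemma le_norm_dualVec (ha : 0 < a) (m : ℤ × ℤ) :
    2 * Real.pi / a * ‖![m.1, m.2]‖ ≤ ‖dualVec a m‖ := by
  have hpi := Real.pi_pos
  have h1 : ‖dualVec a m‖ ^ 2 = _ := norm_sq_comb ha m.1 m.2
  have h2 : ∀ s t : ℝ, (2 * Real.pi / a * |s|) ^ 2 ≤
      16 * Real.pi ^ 2 / (3 * a ^ 2) * (s ^ 2 + t ^ 2 - s * t) := by
    intro s t
    have : 16 * Real.pi ^ 2 / (3 * a ^ 2) * (s ^ 2 + t ^ 2 - s * t) - (2 * Real.pi / a * |s|) ^ 2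
        = 4 * Real.pi ^ 2 / (3 * a ^ 2) * (2 * t - s) ^ 2 := by
      rw [mul_pow, sq_abs]
      field_simp
      ring
    have h3 : 0 ≤ 4 * Real.pi ^ 2 / (3 * a ^ 2) * (2 * t - s) ^ 2 := by positivity
    linarith
  have h3 : ‖![m.1, m.2]‖ = |(m.1 : ℝ)| ∨ ‖![m.1, m.2]‖ = |(m.2 : ℝ)| := by
    rw [EisensteinSeries.norm_eq_max_natAbs]
    rcases max_choice (m.1.natAbs) (m.2.natAbs) with h | h
    · left; simp [h, Nat.cast_natAbs]
    · right; simp [h, Nat.cast_natAbs]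
  apply le_of_sq_le_sq _ (norm_nonneg _)
  rw [h1]
  rcases h3 with h | h
  · rw [h]; exact h2 _ _
  · rw [h]
    exact (h2 m.2 m.1).trans_eq (by ring)

lemma summable_decay (ha : 0 < a) : Summable (decay a) := by
  have hpi := Real.pi_pos
  have h1 := (finTwoArrowEquiv ℤ).symm.summable_iff.mpr
    (EisensteinSeries.summable_one_div_norm_rpow (k := 3) (by norm_num))
  refine Summable.of_norm_bounded_eventually (h1.mul_left ((2 * Real.pi / a) ^ 3)⁻¹) ?_
  -- The comparison fails at `m = 0`: there the real power `0 ^ (-3)` is `0`, while `decay a 0 = 1`.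
  refine (Set.finite_singleton (0 : ℤ × ℤ)).subset ?_
  intro m hm
  by_contra hm0
  apply hm
  have h0 : 0 < ‖![m.1, m.2]‖ := by
    rw [norm_pos_iff]
    intro h
    apply hm0
    have e1 := congrFun h 0
    have e2 := congrFun h 1
    simp at e1 e2
    exact Prod.ext e1 e2
  have h2 := le_norm_dualVec ha m
  change ‖decay a m‖ ≤ ((2 * Real.pi / a) ^ 3)⁻¹ * ‖![m.1, m.2]‖ ^ (-3 : ℝ)
  rw [Real.norm_of_nonneg (decay_nonneg a m), decay, Real.rpow_neg h0.le,
    ← mul_inv]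
  norm_cast
  rw [← mul_pow]
  gcongr
  push_cast
  linarith

/-- Peetre's inequality. It pulls the dependence on `k` out of the lattice sums as a factor `(1 +
‖k‖) ^ 3`, which makes the bounds locally uniform in `k`. -/
lemma one_add_norm_le (x y : Plane) : 1 + ‖x‖ ≤ (1 + ‖x + y‖) * (1 + ‖y‖) := by
  have h1 : ‖x‖ ≤ ‖x + y‖ + ‖y‖ := by simpa using norm_sub_le (x + y) y
  nlinarith [norm_nonneg (x + y), norm_nonneg y]

lemma inv_one_add_norm_pow_le (a : ℝ) (k : Plane) (m : ℤ × ℤ) :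
    ((1 + ‖dualVec a m + k‖) ^ 3)⁻¹ ≤ (1 + ‖k‖) ^ 3 * decay a m := by
  have h := one_add_norm_le (dualVec a m) k
  rw [decay, ← div_eq_mul_inv, inv_le_comm₀ (by positivity) (by positivity), inv_div,
    div_le_iff₀ (by positivity), ← mul_pow]
  gcongr

lemma freeEigenvalue_nonneg (a : ℝ) (k : Plane) (m : ℤ × ℤ) : 0 ≤ freeEigenvalue a k m :=
  sq_nonneg _

lemma inv_freeEigenvalue_add_one_sq_le (a : ℝ) (k : Plane) (m : ℤ × ℤ) :
    ((freeEigenvalue a k m + 1) ^ 2)⁻¹ ≤ 4 * (1 + ‖k‖) ^ 3 * decay a m := by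
  have h := inv_one_add_norm_pow_le a k m
  have h0 := norm_nonneg (dualVec a m + k)
  have h1 : ((freeEigenvalue a k m + 1) ^ 2)⁻¹ ≤ 4 * ((1 + ‖dualVec a m + k‖) ^ 3)⁻¹ := by
    rw [freeEigenvalue, ← div_eq_mul_inv, inv_le_comm₀ (by positivity) (by positivity), inv_div,
      div_le_iff₀ (by positivity)]
    set p := ‖dualVec a m + k‖
    have h2 : (1 + p) ^ 2 ≤ 2 * (p ^ 2 + 1) := by nlinarith [sq_nonneg (p - 1)]
    -- The available fourth power is weakened to the third, so that one majorant serves here and for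
    -- `cellError`.
    have h3 : (1 + p) ^ 3 ≤ (1 + p) ^ 4 := pow_le_pow_right₀ (by linarith) (by norm_num)
    nlinarith [pow_le_pow_left₀ (by positivity) h2 2]
  linarith

lemma summable_inv_sq (ha : 0 < a) (k : Plane) :
    Summable fun m => ((freeEigenvalue a k m + 1) ^ 2)⁻¹ :=
  Summable.of_nonneg_of_le (fun m => by positivity) (inv_freeEigenvalue_add_one_sq_le a k)
    ((summable_decay ha).mul_left _)

lemma tendsto_freeEigenvalue (ha : 0 < a) (k : Plane) :
    Tendsto (freeEigenvalue a k) cofinite atTop := by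
  rw [tendsto_atTop]
  intro b
  have h := (summable_inv_sq ha k).tendsto_cofinite_zero
  have hb : 0 < ((|b| + 1) ^ 2)⁻¹ := by positivity
  filter_upwards [h.eventually_lt_const hb] with m hm
  have h0 := freeEigenvalue_nonneg a k m
  rw [inv_lt_inv₀ (by positivity) (by positivity)] at hm
  have := lt_of_pow_lt_pow_left₀ 2 (by positivity) hm
  have := le_abs_self b
  linarith

lemma finite_freeEigenvalue_le (ha : 0 < a) (k : Plane) (b : ℝ) :
    {m | freeEigenvalue a k m ≤ b}.Finite := by
  have h := (tendsto_freeEigenvalue ha k).eventually_gt_atTop b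
  refine h.subset fun m hm => ?_
  simpa using hm

lemma finite_norm_le (ha : 0 < a) (k : Plane) (r : ℝ) :
    {m : ℤ × ℤ | ‖dualVec a m + k‖ ≤ r}.Finite := by
  refine (finite_freeEigenvalue_le ha k (r ^ 2)).subset fun m (hm : _ ≤ r) => ?_
  exact pow_le_pow_left₀ (norm_nonneg _) hm 2

/-- The dual lattice points `ξ_m + k` in the ball of radius `r`. -/
noncomputable def ballIndices (ha : 0 < a) (k : Plane) (r : ℝ) : Finset (ℤ × ℤ) :=
  (finite_norm_le ha k r).toFinset

lemma mem_ballIndices (ha : 0 < a) (k : Plane) (r : ℝ) (m : ℤ × ℤ) :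
    m ∈ ballIndices ha k r ↔ ‖dualVec a m + k‖ ≤ r := by
  simp [ballIndices]

lemma tendsto_ballIndices (ha : 0 < a) (k : Plane) :
    Tendsto (ballIndices ha k) atTop atTop := by
  apply tendsto_atTop_finset_of_monotone
  · intro r s hrs m hm
    rw [mem_ballIndices] at hm ⊢
    exact hm.trans hrs
  · intro m
    exact ⟨‖dualVec a m + k‖, (mem_ballIndices ha k _ m).mpr le_rfl⟩

lemma finsum_norm_le_eq (ha : 0 < a) (k : Plane) (r : ℝ) (f : ℤ × ℤ → ℝ) :
    ∑ᶠ m ∈ {m : ℤ × ℤ | ‖dualVec a m + k‖ ≤ r}, f m = ∑ m ∈ ballIndices ha k r, f m :=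
  finsum_mem_eq_finite_toFinset_sum _ _

/-! ### Comparison with the integral -/

/-- The translate of the fundamental parallelogram of the dual lattice with corner `ξ_m + k`. -/
def dualCell (a : ℝ) (k : Plane) (m : ℤ × ℤ) : Set Plane :=
  {x | ⌊coords (v₁ a) (v₂ a) (x - k) 0⌋ = m.1 ∧ ⌊coords (v₁ a) (v₂ a) (x - k) 1⌋ = m.2}

lemma dualCell_eq (a : ℝ) (k : Plane) (m : ℤ × ℤ) :
    dualCell a k m = coords (v₁ a) (v₂ a) ⁻¹' (Set.univ.pi fun i =>
      Set.Ico (coords (v₁ a) (v₂ a) k i + (![m.1, m.2] i : ℤ))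
        (coords (v₁ a) (v₂ a) k i + (![m.1, m.2] i : ℤ) + 1)) := by
  ext x
  simp only [dualCell, Set.mem_ofPred_eq, Set.mem_preimage, Set.mem_univ_pi, Fin.forall_fin_two,
    coords_sub, Int.floor_eq_iff, Set.mem_Ico, Pi.sub_apply, Matrix.cons_val_zero,
    Matrix.cons_val_one]
  constructor <;> rintro ⟨⟨h1, h2⟩, h3, h4⟩ <;> refine ⟨⟨?_, ?_⟩, ?_, ?_⟩ <;> linarith

lemma measurableSet_dualCell (a : ℝ) (k : Plane) (m : ℤ × ℤ) : MeasurableSet (dualCell a k m) := by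
  rw [dualCell_eq]
  exact (continuous_coords _ _).measurable (MeasurableSet.univ_pi fun _ => measurableSet_Ico)

lemma volume_dualCell (ha : 0 < a) (k : Plane) (m : ℤ × ℤ) :
    volume (dualCell a k m) = ENNReal.ofReal (areaB a) := by
  rw [dualCell_eq, (dualPair_v_k ha).measurePreserving_coords.measure_preimage
    (MeasurableSet.univ_pi fun _ => measurableSet_Ico).nullMeasurableSet]
  simp [volume_pi_pi, areaB]

lemma pairwise_disjoint_dualCell (a : ℝ) (k : Plane) :
    Pairwise (Function.onFun Disjoint (dualCell a k)) := by
  intro m n hmn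
  refine Set.disjoint_left.mpr fun x hx hy => hmn ?_
  exact Prod.ext (hx.1.symm.trans hy.1) (hx.2.symm.trans hy.2)

lemma exists_mem_dualCell (a : ℝ) (k x : Plane) : ∃ m, x ∈ dualCell a k m :=
  ⟨(_, _), rfl, rfl⟩

/-- A bound for the diameter of the cells of the dual lattice. -/
noncomputable def cellDiam (a : ℝ) : ℝ := ‖k₁ a‖ + ‖k₂ a‖

lemma cellDiam_nonneg (a : ℝ) : 0 ≤ cellDiam a := by unfold cellDiam; positivity

lemma norm_sub_le_of_mem_dualCell (ha : 0 < a) {k x : Plane} {m : ℤ × ℤ} (hx : x ∈ dualCell a k m) :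
    ‖x - (dualVec a m + k)‖ ≤ cellDiam a := by
  have h := dualPair_v_k ha
  have e : x - (dualVec a m + k) = Int.fract (coords (v₁ a) (v₂ a) (x - k) 0) • k₁ a +
      Int.fract (coords (v₁ a) (v₂ a) (x - k) 1) • k₂ a := by
    nth_rw 1 [← sub_sub, sub_right_comm, ← h.comb_coords (x - k)]
    rw [Int.fract, Int.fract, hx.1, hx.2, dualVec]
    module
  rw [e]
  refine (norm_add_le _ _).trans (add_le_add ?_ ?_) <;>
  · rw [norm_smul, Real.norm_of_nonneg (Int.fract_nonneg _)]
    exact mul_le_of_le_one_left (norm_nonneg _) (Int.fract_lt_one _).le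

/-- The function `(1 + |x|²)⁻¹`. -/
noncomputable def bump (x : Plane) : ℝ := (‖x‖ ^ 2 + 1)⁻¹

lemma bump_pos (x : Plane) : 0 < bump x := by unfold bump; positivity

lemma continuous_bump : Continuous bump := by
  unfold bump
  exact Continuous.inv₀ (by fun_prop) fun x => by positivity

lemma bump_dualVec (a : ℝ) (k : Plane) (m : ℤ × ℤ) :
    bump (dualVec a m + k) = (freeEigenvalue a k m + 1)⁻¹ := rfl

/-- The gradient of `(1 + |x|²)⁻¹` decays like the third power. The difference is factored exactly,
and `1 + ‖p‖ ≤ (1 + ‖x‖) (1 + d)` transfers the decay from `x` to `p`. -/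
lemma abs_bump_sub_le {d : ℝ} {p x : Plane} (h : ‖x - p‖ ≤ d) :
    |bump p - bump x| ≤ 8 * d * (1 + d) ^ 2 * ((1 + ‖p‖) ^ 3)⁻¹ := by
  have hd : 0 ≤ d := (norm_nonneg _).trans h
  have h1 : |‖x‖ - ‖p‖| ≤ d := (abs_norm_sub_norm_le x p).trans h
  have h2 : 1 + ‖p‖ ≤ (1 + ‖x‖) * (1 + d) := by
    have := (abs_le.mp h1).1
    nlinarith [norm_nonneg x]
  unfold bump
  have hp := norm_nonneg p
  have hx := norm_nonneg x
  generalize ‖p‖ = p at *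
  generalize ‖x‖ = x at *
  have h3 : (p ^ 2 + 1)⁻¹ - (x ^ 2 + 1)⁻¹ = (x - p) * ((x + p) * ((p ^ 2 + 1)⁻¹ * (x ^ 2 + 1)⁻¹)) := by
    field_simp
    ring
  have hP : (p ^ 2 + 1)⁻¹ ≤ 2 * ((1 + p) ^ 2)⁻¹ := by
    rw [← div_eq_mul_inv, inv_le_comm₀ (by positivity) (by positivity), inv_div,
      div_le_iff₀ (by positivity)]
    nlinarith [sq_nonneg (p - 1)]
  have hX : (x ^ 2 + 1)⁻¹ ≤ 2 * ((1 + x) ^ 2)⁻¹ := by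
    rw [← div_eq_mul_inv, inv_le_comm₀ (by positivity) (by positivity), inv_div,
      div_le_iff₀ (by positivity)]
    nlinarith [sq_nonneg (x - 1)]
  have hu : (1 + x)⁻¹ ≤ (1 + d) * (1 + p)⁻¹ := by
    rw [← div_eq_mul_inv, inv_le_comm₀ (by positivity) (by positivity), inv_div,
      div_le_iff₀ (by positivity)]
    exact h2
  have hxp : x + p ≤ (1 + x) * (1 + p) := by nlinarith
  rw [h3, abs_mul, abs_of_nonneg (by positivity : 0 ≤ (x + p) * ((p ^ 2 + 1)⁻¹ * (x ^ 2 + 1)⁻¹))]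
  have key : (x + p) * ((p ^ 2 + 1)⁻¹ * (x ^ 2 + 1)⁻¹) ≤
      8 * (1 + d) ^ 2 * ((1 + p) ^ 3)⁻¹ := by
    calc (x + p) * ((p ^ 2 + 1)⁻¹ * (x ^ 2 + 1)⁻¹)
        ≤ ((1 + x) + (1 + p)) * ((2 * ((1 + p) ^ 2)⁻¹) * (2 * ((1 + x) ^ 2)⁻¹)) := by
          gcongr <;> linarith
      _ = 4 * ((1 + p)⁻¹ ^ 2 * (1 + x)⁻¹) + 4 * ((1 + p)⁻¹ * (1 + x)⁻¹ ^ 2) := by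
          field_simp
          norm_num
      _ ≤ 4 * ((1 + p)⁻¹ ^ 2 * ((1 + d) * (1 + p)⁻¹)) +
          4 * ((1 + p)⁻¹ * ((1 + d) * (1 + p)⁻¹) ^ 2) := by gcongr
      _ = (4 * (1 + d) + 4 * (1 + d) ^ 2) * ((1 + p) ^ 3)⁻¹ := by field_simp
      _ ≤ 8 * (1 + d) ^ 2 * ((1 + p) ^ 3)⁻¹ := by
          gcongr
          nlinarith
  calc |x - p| * _ ≤ d * (8 * (1 + d) ^ 2 * ((1 + p) ^ 3)⁻¹) :=
        mul_le_mul h1 key (by positivity) hd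
    _ = _ := by ring

lemma integrableOn_bump (s : Set Plane) (hs : Bornology.IsBounded s) : IntegrableOn bump s := by
  obtain ⟨R, hR⟩ := hs.subset_closedBall 0
  exact (continuous_bump.continuousOn.integrableOn_compact (isCompact_closedBall 0 R)).mono_set hR

/-- Polar coordinates. This integral is the source of the counterterm `2π ln r` in the Green
function. -/
lemma integral_bump_closedBall {R : ℝ} (hR : 0 ≤ R) :
    ∫ x in Metric.closedBall (0 : Plane) R, bump x = Real.pi * Real.log (1 + R ^ 2) := by
  have h1 : ∫ x in Metric.closedBall (0 : Plane) R, bump x =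
      ∫ x : Plane, (Set.Iic R).indicator (fun y : ℝ => (y ^ 2 + 1)⁻¹) ‖x‖ := by
    rw [← integral_indicator measurableSet_closedBall]
    congr 1
    ext x
    simp [Set.indicator, bump]
  have h2 : volume.real (Metric.ball (0 : Plane) 1) = Real.pi := by
    rw [Measure.real, EuclideanSpace.volume_ball_fin_two]
    simp [Real.pi_pos.le]
  have h3 : ∫ y in Set.Ioi (0 : ℝ), y ^ (2 - 1) • (Set.Iic R).indicator
      (fun y : ℝ => (y ^ 2 + 1)⁻¹) y = ∫ y in (0 : ℝ)..R, y * (y ^ 2 + 1)⁻¹ := by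
    rw [intervalIntegral.integral_of_le hR, ← Set.Ioi_inter_Iic,
      ← setIntegral_indicator measurableSet_Iic]
    congr 1
    ext y
    by_cases hy : y ≤ R <;> simp [Set.indicator, hy]
  have h4 : ∫ y in (0 : ℝ)..R, y * (y ^ 2 + 1)⁻¹ = Real.log (1 + R ^ 2) / 2 := by
    have hderiv : ∀ y ∈ Set.uIcc 0 R,
        HasDerivAt (fun y : ℝ => Real.log (1 + y ^ 2) / 2) (y * (y ^ 2 + 1)⁻¹) y := by
      intro y _
      have h5 : HasDerivAt (fun y : ℝ => 1 + y ^ 2) (2 * y) y := by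
        simpa using (hasDerivAt_pow 2 y).const_add 1
      have h6 := (h5.log (by positivity)).div_const 2
      rwa [div_div, mul_comm (1 + y ^ 2), mul_div_mul_left _ _ two_ne_zero, add_comm 1 (y ^ 2),
        div_eq_mul_inv] at h6
    rw [intervalIntegral.integral_eq_sub_of_hasDerivAt hderiv]
    · simp
    · apply Continuous.intervalIntegrable
      exact continuous_id.mul (Continuous.inv₀ (by fun_prop) fun y => by positivity)
  rw [h1, integral_fun_norm_addHaar, h2, finrank_euclideanSpace_fin, h3, h4]
  simp
  ring

end LatticeSums

/-! ### The renormalised Green function -/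

section Green

variable {a : ℝ}

/-- The error in replacing the integral of `bump` over a dual cell by its value at the corner. -/
noncomputable def cellError (a : ℝ) (k : Plane) (m : ℤ × ℤ) : ℝ :=
  areaB a * (freeEigenvalue a k m + 1)⁻¹ - ∫ x in dualCell a k m, bump x

lemma dualCell_subset_closedBall (ha : 0 < a) (k : Plane) (m : ℤ × ℤ) :
    dualCell a k m ⊆ Metric.closedBall (dualVec a m + k) (cellDiam a) := fun x hx => by
  rw [mem_closedBall_iff_norm]
  exact norm_sub_le_of_mem_dualCell ha hx

lemma integrableOn_bump_dualCell (ha : 0 < a) (k : Plane) (m : ℤ × ℤ) :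
    IntegrableOn bump (dualCell a k m) :=
  integrableOn_bump _ (Metric.isBounded_closedBall.subset (dualCell_subset_closedBall ha k m))

lemma abs_cellError_le (ha : 0 < a) (k : Plane) (m : ℤ × ℤ) :
    |cellError a k m| ≤ 8 * cellDiam a * (1 + cellDiam a) ^ 2 * areaB a * (1 + ‖k‖) ^ 3 *
      decay a m := by
  have hB := areaB_pos ha
  have hd := cellDiam_nonneg a
  have hv : volume.real (dualCell a k m) = areaB a := by
    rw [Measure.real, volume_dualCell ha, ENNReal.toReal_ofReal hB.le]
  have hv' : volume (dualCell a k m) < ⊤ := by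
    rw [volume_dualCell ha]; exact ENNReal.ofReal_lt_top
  have h1 : cellError a k m = ∫ x in dualCell a k m, (bump (dualVec a m + k) - bump x) := by
    rw [integral_sub (integrable_const_iff.mpr (Or.inr ⟨by simpa using hv'⟩)) (integrableOn_bump_dualCell ha k m),
      setIntegral_const, hv, cellError, bump_dualVec, smul_eq_mul]
  have h2 := norm_setIntegral_le_of_norm_le_const (f := fun x => bump (dualVec a m + k) - bump x)
    (C := 8 * cellDiam a * (1 + cellDiam a) ^ 2 * ((1 + ‖dualVec a m + k‖) ^ 3)⁻¹) hv'
    (fun x hx => abs_bump_sub_le (norm_sub_le_of_mem_dualCell ha hx))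
  rw [← h1, hv, Real.norm_eq_abs] at h2
  calc _ ≤ _ := h2
    _ ≤ 8 * cellDiam a * (1 + cellDiam a) ^ 2 * ((1 + ‖k‖) ^ 3 * decay a m) * areaB a := by
        gcongr
        exact inv_one_add_norm_pow_le a k m
    _ = _ := by ring

lemma summable_cellError (ha : 0 < a) (k : Plane) : Summable (cellError a k) :=
  Summable.of_norm_bounded ((summable_decay ha).mul_left _) (abs_cellError_le ha k)

/-- The constant `lim_r ∑_{|ξ_m + k| ≤ r} (|ξ_m + k|² + 1)⁻¹ - (2π / area(𝓑)) ln r`. -/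
noncomputable def greenConst (a : ℝ) (k : Plane) : ℝ := (areaB a)⁻¹ * ∑' m, cellError a k m

lemma abs_greenConst_le (ha : 0 < a) (k : Plane) :
    |greenConst a k| ≤ 8 * cellDiam a * (1 + cellDiam a) ^ 2 * (1 + ‖k‖) ^ 3 * ∑' m, decay a m := by
  have hB := areaB_pos ha
  have h := tsum_of_norm_bounded (f := cellError a k) (((summable_decay ha).hasSum).mul_left _) (abs_cellError_le ha k)
  rw [greenConst, abs_mul, abs_of_pos (by positivity), ← Real.norm_eq_abs (∑' m, _)]
  calc _ ≤ (areaB a)⁻¹ * _ := mul_le_mul_of_nonneg_left h (by positivity)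
    _ = _ := by field_simp

/-- The first term is the integral of `bump` over a ball of radius `r + c`, for `r + c ≥ 0`; a
bounded change of the radius does not affect the logarithmic asymptotics. -/
lemma tendsto_log_shift (c : ℝ) :
    Tendsto (fun r : ℝ => Real.pi * Real.log (1 + (r + c) ^ 2) - 2 * Real.pi * Real.log r)
      atTop (𝓝 0) := by
  have h1 : Tendsto (fun r : ℝ => (r⁻¹) ^ 2 + (1 + c * r⁻¹) ^ 2) atTop (𝓝 1) := by
    have := tendsto_inv_atTop_zero (𝕜 := ℝ)
    simpa using (this.pow 2).add (((this.const_mul c).const_add 1).pow 2)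
  have h2 := ((Real.continuousAt_log one_ne_zero).tendsto.comp h1).const_mul Real.pi
  rw [Real.log_one, mul_zero] at h2
  refine h2.congr' ?_
  filter_upwards [eventually_gt_atTop 0] with r hr
  have e : (r⁻¹) ^ 2 + (1 + c * r⁻¹) ^ 2 = (1 + (r + c) ^ 2) / r ^ 2 := by field_simp
  rw [Function.comp_apply, e, Real.log_div (by positivity) (by positivity), Real.log_pow]
  push_cast
  ring

/-- The union of the cells with corner in the ball of radius `r` lies between the balls of radii `r
- cellDiam a` and `r + cellDiam a`. -/
lemma tendsto_integral_cells (ha : 0 < a) (k : Plane) :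
    Tendsto (fun r : ℝ => (∑ m ∈ ballIndices ha k r, ∫ x in dualCell a k m, bump x)
      - 2 * Real.pi * Real.log r) atTop (𝓝 0) := by
  have hd := cellDiam_nonneg a
  refine tendsto_of_tendsto_of_tendsto_of_le_of_le' (tendsto_log_shift (-cellDiam a))
    (tendsto_log_shift (cellDiam a)) ?_ ?_
  all_goals
    filter_upwards [eventually_ge_atTop (cellDiam a)] with r hr
    rw [← integral_biUnion_finset _ (fun m _ => measurableSet_dualCell a k m)
      (fun m _ n _ hmn => pairwise_disjoint_dualCell a k hmn)
      (fun m _ => integrableOn_bump_dualCell ha k m)]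
    gcongr
  · rw [← integral_bump_closedBall (by linarith)]
    refine setIntegral_mono_set ?_ (Eventually.of_forall fun x => (bump_pos x).le)
      (LE.le.eventuallyLE ?_)
    · refine integrableOn_bump _ ?_
      rw [Bornology.isBounded_biUnion_finset]
      exact fun m _ => Metric.isBounded_closedBall.subset (dualCell_subset_closedBall ha k m)
    · intro x hx
      obtain ⟨m, hm⟩ := exists_mem_dualCell a k x
      refine Set.mem_biUnion (x := m) ?_ hm
      rw [Finset.mem_coe, mem_ballIndices]
      rw [mem_closedBall_zero_iff] at hx
      have h1 := norm_sub_le_of_mem_dualCell ha hm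
      have h2 := norm_sub_norm_le (dualVec a m + k) x
      rw [norm_sub_rev] at h2
      linarith
  · rw [← integral_bump_closedBall (by linarith)]
    refine setIntegral_mono_set (integrableOn_bump _ Metric.isBounded_closedBall)
      (Eventually.of_forall fun x => (bump_pos x).le) (LE.le.eventuallyLE ?_)
    intro x hx
    obtain ⟨m, hm, hx⟩ := Set.mem_iUnion₂.mp hx
    rw [mem_ballIndices] at hm
    rw [mem_closedBall_zero_iff]
    have h1 := norm_sub_le_of_mem_dualCell ha hx
    have h2 := norm_sub_norm_le x (dualVec a m + k)
    linarith

/-- Each summand times `areaB a` is the integral of `bump` over its cell plus a summable error. The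
integrals carry the logarithm and the errors add up to the constant. -/
lemma tendsto_greenConst (ha : 0 < a) (k : Plane) :
    Tendsto (fun r : ℝ => (∑ m ∈ ballIndices ha k r, (freeEigenvalue a k m + 1)⁻¹)
      - 2 * Real.pi / areaB a * Real.log r) atTop (𝓝 (greenConst a k)) := by
  have hB := areaB_pos ha
  have h1 := (summable_cellError ha k).hasSum.comp (tendsto_ballIndices ha k)
  have h2 := ((h1.add (tendsto_integral_cells ha k)).const_mul (areaB a)⁻¹)
  rw [add_zero] at h2
  refine h2.congr fun r => ?_
  simp only [Function.comp_apply, cellError, Finset.sum_sub_distrib, ← Finset.mul_sum]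
  field_simp
  ring

lemma inv_sub_inv_eq {E l : ℝ} (h : E ≠ l) (hE : 0 ≤ E) :
    (E - l)⁻¹ - (E + 1)⁻¹ = (l + 1) * ((E - l)⁻¹ * (E + 1)⁻¹) := by
  have h1 : E - l ≠ 0 := sub_ne_zero.mpr h
  field_simp
  ring

lemma summable_inv_sub (ha : 0 < a) (k : Plane) {lam : ℝ} (h : ∀ m, freeEigenvalue a k m ≠ lam) :
    Summable fun m => (freeEigenvalue a k m - lam)⁻¹ - (freeEigenvalue a k m + 1)⁻¹ := by
  refine Summable.of_norm_bounded_eventually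
    ((summable_inv_sq ha k).mul_left (|lam + 1| * 2)) ?_
  filter_upwards [(tendsto_freeEigenvalue ha k).eventually_ge_atTop (2 * lam + 1)] with m hm
  have h0 := freeEigenvalue_nonneg a k m
  rw [inv_sub_inv_eq (h m) h0, norm_mul, Real.norm_eq_abs, mul_assoc]
  have hpos : 0 < freeEigenvalue a k m - lam := by
    rcases lt_or_ge lam 0 with hl | hl <;> linarith
  rw [Real.norm_of_nonneg (by positivity)]
  refine mul_le_mul_of_nonneg_left ?_ (abs_nonneg _)
  rw [sq, mul_inv, ← mul_assoc]
  refine mul_le_mul_of_nonneg_right ?_ (by positivity)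
  rw [← div_eq_mul_inv, inv_le_comm₀ hpos (by positivity), inv_div,
      div_le_iff₀ (by positivity)]
  linarith

/-- `area(Γ) g_lam(0, k)` in terms of an absolutely convergent series. -/
lemma areaΓ_mul_greenDiag (ha : 0 < a) (k : Plane) {lam : ℝ}
    (h : ∀ m, freeEigenvalue a k m ≠ lam) :
    areaΓ a * greenDiag a k lam = greenConst a k +
      ∑' m, ((freeEigenvalue a k m - lam)⁻¹ - (freeEigenvalue a k m + 1)⁻¹) := by
  have hA := areaΓ_pos ha
  have h1 := (summable_inv_sub ha k h).hasSum.comp (tendsto_ballIndices ha k)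
  have h2 := (tendsto_greenConst ha k).add h1
  rw [greenDiag, mul_inv_cancel_left₀ hA.ne']
  -- `limUnder` has an arbitrary value unless the limit exists; here convergence is established
  -- along with the value.
  apply Tendsto.limUnder_eq
  refine h2.congr fun r => ?_
  rw [finsum_norm_le_eq ha, Function.comp_apply, Finset.sum_sub_distrib]
  ring

/-- The counterterm and `greenConst` do not involve the spectral parameter and cancel in the
difference. -/
lemma hasSum_green_sub (ha : 0 < a) (k : Plane) {mu lam : ℝ}
    (h : ∀ m, freeEigenvalue a k m ≠ mu) (h' : ∀ m, freeEigenvalue a k m ≠ lam) :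
    HasSum (fun m => (freeEigenvalue a k m - mu)⁻¹ - (freeEigenvalue a k m - lam)⁻¹)
      (areaΓ a * (greenDiag a k mu - greenDiag a k lam)) := by
  have h1 := (summable_inv_sub ha k h).hasSum.sub (summable_inv_sub ha k h').hasSum
  convert! h1 using 1
  · ext m; ring
  · rw [mul_sub, areaΓ_mul_greenDiag ha k h, areaΓ_mul_greenDiag ha k h']
    ring

/-- The sum over the ball of radius `r` grows like `ln r`, by `tendsto_greenConst`. -/
lemma exists_lt_sum_inv (ha : 0 < a) (k : Plane) (b : ℝ) :
    ∃ S : Finset (ℤ × ℤ), b < ∑ m ∈ S, (freeEigenvalue a k m + 1)⁻¹ := by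
  have hB := areaB_pos ha
  have h2 : Tendsto (fun r : ℝ => 2 * Real.pi / areaB a * Real.log r) atTop atTop :=
    Real.tendsto_log_atTop.const_mul_atTop (by positivity)
  have h1 := (tendsto_greenConst ha k).add_atTop h2
  obtain ⟨r, hr⟩ := (h1.eventually_gt_atTop b).exists
  exact ⟨ballIndices ha k r, by simpa using hr⟩

/-- `g_lam(0, k) → -∞` as `lam → -∞`. -/
lemma tendsto_greenDiag_atBot (ha : 0 < a) (k : Plane) :
    Tendsto (fun lam => areaΓ a * greenDiag a k lam) atBot atBot := by
  rw [tendsto_atBot]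
  intro b
  -- For `lam < -1` every term of the series is nonpositive, so the part over `S` bounds it from
  -- above. On `S` the first halves of the terms tend to `0` and the second halves sum to more than
  -- `greenConst a k - b`.
  obtain ⟨S, hS⟩ := exists_lt_sum_inv ha k (greenConst a k - b)
  have h1 : Tendsto (fun lam => ∑ m ∈ S, (freeEigenvalue a k m - lam)⁻¹) atBot (𝓝 0) := by
    rw [← Finset.sum_const_zero (s := S)]
    refine tendsto_finsetSum _ fun m _ => ?_
    exact tendsto_inv_atTop_zero.comp (tendsto_atTop_add_const_left _ _ tendsto_neg_atBot_atTop)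
  have h2 := h1.eventually_lt_const (sub_pos.mpr hS)
  filter_upwards [h2, eventually_lt_atBot (-1)] with lam h3 h4
  have h5 : ∀ m, freeEigenvalue a k m ≠ lam := fun m => by
    have := freeEigenvalue_nonneg a k m
    linarith
  rw [areaΓ_mul_greenDiag ha k h5]
  have h6 : ∀ m, (freeEigenvalue a k m - lam)⁻¹ - (freeEigenvalue a k m + 1)⁻¹ ≤ 0 := fun m => by
    have := freeEigenvalue_nonneg a k m
    rw [sub_nonpos]
    gcongr
    linarith
  have h7 := (summable_inv_sub ha k h5).neg.sum_le_tsum S (fun m _ => neg_nonneg.mpr (h6 m))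
  rw [tsum_neg, Finset.sum_neg_distrib, Finset.sum_sub_distrib] at h7
  linarith

end Green

/-! ### The eigenspaces of the point scatterer -/

section Eigenspaces

variable {a α : ℝ} {k : Plane}

/-- The real points at which the resolvent is given by Krein's formula. -/
def Admissible (a α : ℝ) (k : Plane) (lam : ℝ) : Prop :=
  (∀ m, freeEigenvalue a k m ≠ lam) ∧ kreinGamma a α k lam ≠ 0

/-- Far to the left `g_lam` is below `α`. Without such a point the condition defining
`scattererGraph` would be vacuous. -/
lemma exists_admissible (ha : 0 < a) (α : ℝ) (k : Plane) : ∃ lam, Admissible a α k lam := by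
  have hA := areaΓ_pos ha
  obtain ⟨lam, h1, h2⟩ := (((tendsto_greenDiag_atBot ha k).eventually_lt_atBot
    (areaΓ a * α)).and (eventually_lt_atBot (0 : ℝ))).exists
  refine ⟨lam, fun m => ?_, ?_⟩
  · have := freeEigenvalue_nonneg a k m
    linarith
  · have := lt_of_mul_lt_mul_left h1 hA.le
    rw [kreinGamma]
    linarith

lemma eq_of_fourierCoeff_eq (ha : 0 < a) {f g : L2k a k}
    (h : ∀ m, fourierCoeff a k m f = fourierCoeff a k m g) : f = g := by
  rw [← sub_eq_zero]
  exact eq_zero_of_fourierCoeff_eq_zero ha _ fun m => by rw [map_sub, h m, sub_self]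

lemma eq_zero_of_summable_const {c : ℂ} (h : Summable fun _ : ℤ × ℤ => ‖c‖ ^ 2) : c = 0 := by
  simpa using (summable_const_iff (β := ℤ × ℤ) (‖c‖ ^ 2)).mp h

/-- `toLinearPMap` has the prescribed graph only if that graph is single valued. If `(0, η)` belongs
to it, all Fourier coefficients of `η` are equal, and a constant sequence is square summable only if
it is zero: the delta function is not in `L²`. -/
lemma graph_scatterer (ha : 0 < a) (α : ℝ) (k : Plane) :
    (scatterer a α k).graph = scattererGraph a α k := by
  apply Submodule.toLinearPMap_graph_eq
  rintro ⟨ψ, η⟩ hp rfl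
  obtain ⟨lam, h1, h2⟩ := exists_admissible ha α k
  obtain ⟨s, -, hs⟩ := hp lam h1 h2
  have h3 : ∀ m, fourierCoeff a k m η = -(((areaΓ a)⁻¹ : ℝ) * ((kreinGamma a α k lam)⁻¹ : ℝ) * s) := by
    intro m
    have h4 := hs m
    have h5 : ((freeEigenvalue a k m - lam : ℝ) : ℂ) ≠ 0 := by
      exact_mod_cast sub_ne_zero.mpr (h1 m)
    simp only [smul_zero, sub_zero, map_zero, defect] at h4
    rw [Complex.ofReal_inv (freeEigenvalue a k m - lam)] at h4
    field_simp at h4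
    rw [eq_neg_iff_add_eq_zero, Complex.ofReal_inv, Complex.ofReal_inv]
    rw [zero_mul] at h4
    simpa using h4.symm
  have h6 := summable_fourierCoeff ha η
  simp only [h3] at h6
  have h7 := eq_zero_of_summable_const h6
  exact eq_zero_of_fourierCoeff_eq_zero ha η fun m => by rw [h3, h7]

/-- Krein's formula with `h = (mu - lam) ψ`, multiplied by `E_m - lam`. The last condition says that
the free operator minus `mu` sends `ψ` to a multiple of the delta function. -/
lemma mem_eigenspace (ha : 0 < a) {mu : ℝ} {ψ : L2k a k} :
    ψ ∈ eigenspace (scatterer a α k) mu ↔ ∀ lam, Admissible a α k lam → ∃ s : ℂ,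
      HasSum (fun m => (((freeEigenvalue a k m - lam)⁻¹ * (mu - lam) : ℝ) : ℂ) *
        fourierCoeff a k m ψ) s ∧
      ∀ m, ((freeEigenvalue a k m - mu : ℝ) : ℂ) * fourierCoeff a k m ψ =
        (((areaΓ a)⁻¹ * (kreinGamma a α k lam)⁻¹ : ℝ) : ℂ) * s := by
  have h0 : ψ ∈ eigenspace (scatterer a α k) mu ↔ (ψ, (mu : ℂ) • ψ) ∈ scattererGraph a α k := by
    rw [eigenspace, graph_scatterer ha]
    rfl
  rw [h0]
  change (∀ lam : ℝ, (∀ m, freeEigenvalue a k m ≠ lam) → kreinGamma a α k lam ≠ 0 → _) ↔ _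
  refine forall_congr' fun lam => ?_
  rw [Admissible, and_imp]
  refine forall_congr' fun h1 => forall_congr' fun _ => exists_congr fun s => ?_
  refine and_congr (iff_of_eq (congrArg (fun f => HasSum f s) (funext fun m => ?_)))
    (forall_congr' fun m => ?_)
  · simp only [defect, Complex.conj_ofReal, map_sub, map_smul, smul_eq_mul]
    push_cast
    ring
  · have h5 : ((freeEigenvalue a k m - lam : ℝ) : ℂ) ≠ 0 := by
      exact_mod_cast sub_ne_zero.mpr (h1 m)
    simp only [map_sub, map_smul, smul_eq_mul, defect]
    rw [Complex.ofReal_inv (freeEigenvalue a k m - lam), ← div_eq_inv_mul, ← div_eq_mul_inv,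
      ← add_div, eq_div_iff h5]
    push_cast
    constructor <;> intro h <;> linear_combination h

lemma summable_inv_sub_sq (ha : 0 < a) (k : Plane) (mu : ℝ) :
    Summable fun m => ‖(((freeEigenvalue a k m - mu)⁻¹ : ℝ) : ℂ)‖ ^ 2 := by
  refine Summable.of_norm_bounded_eventually ((summable_inv_sq ha k).mul_left 4) ?_
  filter_upwards [(tendsto_freeEigenvalue ha k).eventually_ge_atTop (2 * mu + 1)] with m hm
  have h0 := freeEigenvalue_nonneg a k m
  have hpos : 0 < freeEigenvalue a k m - mu := by
    rcases lt_or_ge mu 0 with hl | hl <;> linarith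
  rw [Real.norm_of_nonneg (by positivity), Complex.norm_real, Real.norm_eq_abs, sq_abs, inv_pow,
    ← div_eq_mul_inv, inv_le_comm₀ (by positivity) (by positivity), inv_div,
    div_le_iff₀ (by positivity)]
  nlinarith

lemma inv_mul_sub_mul_inv {E mu lam : ℝ} (h1 : E ≠ mu) (h2 : E ≠ lam) :
    (E - lam)⁻¹ * (mu - lam) * (E - mu)⁻¹ = (E - mu)⁻¹ - (E - lam)⁻¹ := by
  have h1' := sub_ne_zero.mpr h1
  have h2' := sub_ne_zero.mpr h2
  field_simp
  ring

lemma hasSum_resolvent (ha : 0 < a) {mu lam : ℝ} (h : ∀ m, freeEigenvalue a k m ≠ mu)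
    (hl : ∀ m, freeEigenvalue a k m ≠ lam) (t : ℂ) :
    HasSum (fun m => (((freeEigenvalue a k m - lam)⁻¹ * (mu - lam) : ℝ) : ℂ) *
      ((((freeEigenvalue a k m - mu)⁻¹ : ℝ) : ℂ) * t))
      (((areaΓ a * (greenDiag a k mu - greenDiag a k lam) : ℝ) : ℂ) * t) := by
  have h1 := (Complex.hasSum_ofReal.mpr (hasSum_green_sub ha k h hl)).mul_right t
  refine h1.congr_fun fun m => ?_
  rw [← mul_assoc, ← Complex.ofReal_mul, inv_mul_sub_mul_inv (h m) (hl m)]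

/-- Off the free spectrum, eigenvectors are multiples of the Green function. -/
lemma fourierCoeff_of_mem_eigenspace (ha : 0 < a) {mu : ℝ} (h : ∀ m, freeEigenvalue a k m ≠ mu)
    {ψ : L2k a k} (hψ : ψ ∈ eigenspace (scatterer a α k) mu) :
    ∃ t : ℂ, (∀ m, fourierCoeff a k m ψ = (((freeEigenvalue a k m - mu)⁻¹ : ℝ) : ℂ) * t) ∧
      (t = 0 ∨ greenDiag a k mu = α) := by
  have hA := (areaΓ_pos ha).ne'
  obtain ⟨lam, hl⟩ := exists_admissible ha α k
  obtain ⟨s, hs, hm⟩ := (mem_eigenspace ha).mp hψ lam hl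
  refine ⟨(((areaΓ a)⁻¹ * (kreinGamma a α k lam)⁻¹ : ℝ) : ℂ) * s, ?_, ?_⟩
  · intro m
    have h5 : ((freeEigenvalue a k m - mu : ℝ) : ℂ) ≠ 0 := by
      exact_mod_cast sub_ne_zero.mpr (h m)
    rw [← hm m, ← mul_assoc, ← Complex.ofReal_mul, inv_mul_cancel₀ (sub_ne_zero.mpr (h m))]
    simp
  · have hc : ∀ m, fourierCoeff a k m ψ = (((freeEigenvalue a k m - mu)⁻¹ : ℝ) : ℂ) *
        ((((areaΓ a)⁻¹ * (kreinGamma a α k lam)⁻¹ : ℝ) : ℂ) * s) := fun m => by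
      rw [← hm m, ← mul_assoc, ← Complex.ofReal_mul, inv_mul_cancel₀ (sub_ne_zero.mpr (h m))]
      simp
    simp only [hc] at hs
    have h1 := hs.unique (hasSum_resolvent ha h hl.1 _)
    have hk := hl.2
    rw [or_iff_not_imp_left]
    intro h0
    have hs0 : s ≠ 0 := right_ne_zero_of_mul h0
    rw [← mul_assoc, ← Complex.ofReal_mul] at h1
    -- Self-consistency of `s`: after cancelling `s ≠ 0` it reads `(g_mu - g_lam) / (α - g_lam) =
    -- 1`.
    have h2 : areaΓ a * (greenDiag a k mu - greenDiag a k lam) *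
        ((areaΓ a)⁻¹ * (kreinGamma a α k lam)⁻¹) = 1 := by
      have h3 := mul_right_cancel₀ hs0 (h1.symm.trans (one_mul s).symm)
      exact_mod_cast h3
    field_simp at h2
    rw [kreinGamma] at h2
    linarith

lemma eigenspace_eq_bot (ha : 0 < a) {mu : ℝ} (h : ∀ m, freeEigenvalue a k m ≠ mu)
    (hg : greenDiag a k mu ≠ α) : eigenspace (scatterer a α k) mu = ⊥ := by
  rw [eq_bot_iff]
  intro ψ hψ
  obtain ⟨t, h1, h2⟩ := fourierCoeff_of_mem_eigenspace ha h hψ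
  rw [Submodule.mem_bot]
  refine eq_zero_of_fourierCoeff_eq_zero ha ψ fun m => ?_
  rw [h1, h2.resolve_right hg, mul_zero]

lemma rank_eigenspace_eq_one (ha : 0 < a) {mu : ℝ} (h : ∀ m, freeEigenvalue a k m ≠ mu)
    (hg : greenDiag a k mu = α) : Module.rank ℂ (eigenspace (scatterer a α k) mu) = 1 := by
  have hA := (areaΓ_pos ha).ne'
  obtain ⟨ψ, hψ⟩ := exists_fourierCoeff_eq ha k (summable_inv_sub_sq ha k mu)
  have hmem : ψ ∈ eigenspace (scatterer a α k) mu := by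
    rw [mem_eigenspace ha]
    intro lam hl
    refine ⟨_, (hasSum_resolvent ha h hl.1 1).congr_fun fun m => ?_, fun m => ?_⟩
    · rw [hψ, mul_one]
    · have hk := hl.2
      rw [hψ, mul_one, ← Complex.ofReal_mul, ← Complex.ofReal_mul, hg, ← kreinGamma]
      have h5 := sub_ne_zero.mpr (h m)
      congr 1
      field_simp
  have hne : ψ ≠ 0 := by
    rintro rfl
    have h1 := hψ 0
    rw [map_zero] at h1
    have h5 := inv_ne_zero (sub_ne_zero.mpr (h 0))
    exact h5 (by exact_mod_cast h1.symm)
  rw [rank_eq_one_iff]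
  refine ⟨⟨ψ, hmem⟩, fun h0 => hne (congrArg Subtype.val h0), fun φ => ?_⟩
  obtain ⟨t, h1, -⟩ := fourierCoeff_of_mem_eigenspace ha h φ.2
  refine ⟨t, Subtype.ext (eq_of_fourierCoeff_eq ha fun m => ?_)⟩
  change fourierCoeff a k m (t • ψ) = _
  rw [map_smul, hψ, h1, smul_eq_mul, mul_comm]

/-- At a free eigenvalue, the eigenspace consists of the free eigenfunctions vanishing at `0`. -/
lemma mem_eigenspace_free (ha : 0 < a) {mu : ℝ} {N : Finset (ℤ × ℤ)} (hN : N.Nonempty)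
    (h : ∀ m, m ∈ N ↔ freeEigenvalue a k m = mu) {ψ : L2k a k} :
    ψ ∈ eigenspace (scatterer a α k) mu ↔
      (∀ m ∉ N, fourierCoeff a k m ψ = 0) ∧ ∑ m ∈ N, fourierCoeff a k m ψ = 0 := by
  have hA := (areaΓ_pos ha).ne'
  have key : ∀ lam, Admissible a α k lam → (∀ m ∉ N, fourierCoeff a k m ψ = 0) →
      HasSum (fun m => (((freeEigenvalue a k m - lam)⁻¹ * (mu - lam) : ℝ) : ℂ) *
        fourierCoeff a k m ψ) (∑ m ∈ N, fourierCoeff a k m ψ) := by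
    intro lam hl h0
    have h1 : ∑ m ∈ N, fourierCoeff a k m ψ = ∑ m ∈ N,
        (((freeEigenvalue a k m - lam)⁻¹ * (mu - lam) : ℝ) : ℂ) * fourierCoeff a k m ψ := by
      refine Finset.sum_congr rfl fun m hm => ?_
      have h2 := (h m).mp hm
      have h3 := sub_ne_zero.mpr (hl.1 m)
      rw [← h2, inv_mul_cancel₀ h3]
      simp
    rw [h1]
    exact hasSum_sum_of_ne_finset_zero fun m hm => by rw [h0 m hm, mul_zero]
  rw [mem_eigenspace ha]
  constructor
  · intro H
    obtain ⟨lam, hl⟩ := exists_admissible ha α k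
    obtain ⟨s, hs, hm⟩ := H lam hl
    -- At an index of `N` the left side of the eigenvalue relation is zero, so the constant on its
    -- right side vanishes for all indices.
    obtain ⟨n, hn⟩ := hN
    have h1 := hm n
    rw [(h n).mp hn, sub_self, Complex.ofReal_zero, zero_mul] at h1
    have h2 : ∀ m ∉ N, fourierCoeff a k m ψ = 0 := by
      intro m hmN
      have h3 := hm m
      rw [← h1, mul_eq_zero] at h3
      refine h3.resolve_left fun h4 => hmN ((h m).mpr ?_)
      exact sub_eq_zero.mp (by exact_mod_cast h4)
    refine ⟨h2, ?_⟩
    rw [(key lam hl h2).unique hs]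
    have h3 := hl.2
    have h4 : (((areaΓ a)⁻¹ * (kreinGamma a α k lam)⁻¹ : ℝ) : ℂ) ≠ 0 := by
      rw [ne_eq, Complex.ofReal_eq_zero]
      positivity
    exact (mul_eq_zero.mp h1.symm).resolve_left h4
  · rintro ⟨h1, h2⟩ lam hl
    refine ⟨0, h2 ▸ key lam hl h1, fun m => ?_⟩
    rw [mul_zero]
    by_cases hm : m ∈ N
    · rw [(h m).mp hm]; simp
    · rw [h1 m hm, mul_zero]

lemma rank_ker_sum {ι : Type} [Fintype ι] [Nonempty ι] :
    Module.rank ℂ (LinearMap.ker (Fintype.linearCombination ℂ (fun _ : ι => (1 : ℂ)))) =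
      (Fintype.card ι - 1 : ℕ) := by
  classical
  have h1 := LinearMap.finrank_range_add_finrank_ker
    (Fintype.linearCombination ℂ (fun _ : ι => (1 : ℂ)))
  have h2 : LinearMap.range (Fintype.linearCombination ℂ (fun _ : ι => (1 : ℂ))) = ⊤ := by
    rw [LinearMap.range_eq_top]
    intro z
    obtain ⟨i⟩ := ‹Nonempty ι›
    exact ⟨Pi.single i z, by simp [Fintype.linearCombination_apply]⟩
  rw [h2, finrank_top, Module.finrank_self, Module.finrank_fintype_fun_eq_card] at h1
  rw [← Module.finrank_eq_rank]
  congr 1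
  omega

/-- The coefficients on `N` are subject to one linear condition, the vanishing of their sum, and
every choice obeying it is realised by Riesz–Fischer. -/
lemma rank_eigenspace_free (ha : 0 < a) (α : ℝ) (k : Plane) {mu : ℝ} {N : Finset (ℤ × ℤ)}
    (hN : N.Nonempty) (h : ∀ m, m ∈ N ↔ freeEigenvalue a k m = mu) :
    Module.rank ℂ (eigenspace (scatterer a α k) mu) = (N.card - 1 : ℕ) := by
  have : Nonempty N := hN.to_subtype
  let Φ : eigenspace (scatterer a α k) mu →ₗ[ℂ] (N → ℂ) :=
    LinearMap.pi fun m => (fourierCoeff a k m).comp (Submodule.subtype _)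
  have hΦ : ∀ ψ m, Φ ψ m = fourierCoeff a k m ψ := fun ψ m => rfl
  have hinj : Function.Injective Φ := by
    rw [injective_iff_map_eq_zero]
    intro ψ h0
    have h1 := ((mem_eigenspace_free ha hN h).mp ψ.2).1
    refine Subtype.ext (eq_zero_of_fourierCoeff_eq_zero ha _ fun m => ?_)
    by_cases hm : m ∈ N
    · exact (hΦ ψ ⟨m, hm⟩).symm.trans (congrFun h0 _)
    · exact h1 m hm
  have hrange : LinearMap.range Φ =
      LinearMap.ker (Fintype.linearCombination ℂ (fun _ : N => (1 : ℂ))) := by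
    ext c
    simp only [LinearMap.mem_range, LinearMap.mem_ker, Fintype.linearCombination_apply, smul_eq_mul,
      mul_one]
    constructor
    · rintro ⟨ψ, rfl⟩
      have h1 := ((mem_eigenspace_free ha hN h).mp ψ.2).2
      exact (Finset.sum_coe_sort N fun m => fourierCoeff a k m ψ).trans h1
    · intro hc
      classical
      let c' : ℤ × ℤ → ℂ := fun m => if hm : m ∈ N then c ⟨m, hm⟩ else 0
      have hs : Summable fun m => ‖c' m‖ ^ 2 :=
        summable_of_ne_finset_zero (s := N) fun m hm => by simp [c', hm]
      obtain ⟨ψ, hψ⟩ := exists_fourierCoeff_eq ha k hs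
      refine ⟨⟨ψ, (mem_eigenspace_free ha hN h).mpr ⟨fun m hm => ?_, ?_⟩⟩, ?_⟩
      · rw [hψ]; simp [c', hm]
      · simp only [hψ]
        rw [← hc, ← Finset.sum_coe_sort]
        exact Finset.sum_congr rfl fun m _ => by simp [c']
      · ext m
        rw [hΦ, hψ]
        simp [c']
  rw [← rank_range_of_injective Φ hinj, hrange, rank_ker_sum, Fintype.card_coe]

end Eigenspaces

/-! ### Counting eigenvalues -/

section Counting

variable {H : Type*} [AddCommGroup H] [Module ℂ H] (A : H →ₗ.[ℂ] H)

lemma mem_eigenspace_iff {A : H →ₗ.[ℂ] H} {lam : ℝ} {x : H} :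
    x ∈ eigenspace A lam ↔ (x, (lam : ℂ) • x) ∈ A.graph := Iff.rfl

lemma eigenspace_inf_eq_bot {lam mu : ℝ} (h : lam ≠ mu) :
    eigenspace A lam ⊓ eigenspace A mu = ⊥ := by
  rw [eq_bot_iff]
  rintro x ⟨h1, h2⟩
  have h3 := A.graph.sub_mem (mem_eigenspace_iff.mp h1) (mem_eigenspace_iff.mp h2)
  have h4 := A.graph_fst_eq_zero_snd h3 (by simp)
  rw [← sub_smul, smul_eq_zero] at h4
  refine h4.resolve_left fun h5 => h ?_
  exact_mod_cast sub_eq_zero.mp h5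

lemma eigenspace_sup_inf_eq_bot {lam mu nu : ℝ} (h1 : lam ≠ mu) (h2 : lam ≠ nu) (h3 : mu ≠ nu) :
    (eigenspace A lam ⊔ eigenspace A mu) ⊓ eigenspace A nu = ⊥ := by
  rw [eq_bot_iff]
  rintro z ⟨hz1, hz2⟩
  obtain ⟨x, hx, y, hy, rfl⟩ := Submodule.mem_sup.mp hz1
  have h4 := A.graph.sub_mem (A.graph.add_mem (mem_eigenspace_iff.mp hx) (mem_eigenspace_iff.mp hy))
    (mem_eigenspace_iff.mp hz2)
  have h5 : ((lam : ℂ) - nu) • x + ((mu : ℂ) - nu) • y = 0 := by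
    rw [← A.graph_fst_eq_zero_snd h4 (by simp)]
    simp only [Prod.snd_add]
    module
  have h6 : ((lam : ℂ) - nu) • x ∈ eigenspace A lam ⊓ eigenspace A mu := by
    refine ⟨Submodule.smul_mem _ _ hx, ?_⟩
    rw [eq_neg_of_add_eq_zero_left h5]
    exact Submodule.neg_mem _ (Submodule.smul_mem _ _ hy)
  rw [eigenspace_inf_eq_bot A h1, Submodule.mem_bot] at h6
  rw [h6, zero_add] at h5
  have hc : ∀ {p q : ℝ}, p ≠ q → (p : ℂ) - q ≠ 0 := fun h h' =>
    h (by exact_mod_cast sub_eq_zero.mp h')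
  have hx0 : x = 0 := (smul_eq_zero.mp h6).resolve_left (hc h2)
  have hy0 : y = 0 := (smul_eq_zero.mp h5).resolve_left (hc h3)
  rw [hx0, hy0, add_zero]
  exact zero_mem _

lemma rank_sup_of_inf_eq_bot {s t : Submodule ℂ H} (h : s ⊓ t = ⊥) :
    Module.rank ℂ (s ⊔ t : Submodule ℂ H) = Module.rank ℂ s + Module.rank ℂ t := by
  rw [← Submodule.rank_sup_add_rank_inf_eq, h, rank_bot, add_zero]

lemma eigenvalueCount_eq_finset {S : Set ℝ} (s : Finset ℝ) (hs : ∀ lam ∈ s, lam ∈ S)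
    (h : ∀ lam ∈ S, lam ∉ s → eigenspace A lam = ⊥) :
    eigenvalueCount A S = Module.rank ℂ (s.sup (eigenspace A) : Submodule ℂ H) := by
  have : (⨆ lam ∈ S, eigenspace A lam) = s.sup (eigenspace A) := by
    apply le_antisymm
    · refine iSup₂_le fun lam hl => ?_
      by_cases hm : lam ∈ s
      · exact Finset.le_sup hm
      · rw [h lam hl hm]; exact bot_le
    · exact Finset.sup_le fun lam hl => le_iSup₂_of_le lam (hs lam hl) le_rfl
  rw [eigenvalueCount, this]

lemma eigenvalueCount_mono {S T : Set ℝ} (h : S ⊆ T) :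
    eigenvalueCount A S ≤ eigenvalueCount A T :=
  Submodule.rank_mono (biSup_mono h)

lemma nthEigenvalue_eq {n : ℕ} {mu : ℝ} (h : IsNthEigenvalue A n mu) : nthEigenvalue A n = mu := by
  have : IsLeast {x : ℝ | (n : Cardinal) ≤ eigenvalueCount A (Set.Iic x)} mu := by
    refine ⟨h.2, fun x hx => ?_⟩
    by_contra! hlt
    refine absurd h.1 (not_lt.mpr (le_trans hx (eigenvalueCount_mono A ?_)))
    exact fun y hy => lt_of_le_of_lt hy hlt
  exact this.csInf_eq

lemma isNthEigenvalue_of_simple {x y z : ℝ} (hxy : x < y) (hyz : y < z)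
    (hx : Module.rank ℂ (eigenspace A x) = 1) (hy : Module.rank ℂ (eigenspace A y) = 1)
    (hz : Module.rank ℂ (eigenspace A z) = 1)
    (h : ∀ lam ≤ z, lam ≠ x → lam ≠ y → lam ≠ z → eigenspace A lam = ⊥) :
    IsNthEigenvalue A 2 y ∧ IsNthEigenvalue A 3 z := by
  have e1 := rank_sup_of_inf_eq_bot (eigenspace_inf_eq_bot A hxy.ne)
  have e2 := rank_sup_of_inf_eq_bot
    (eigenspace_sup_inf_eq_bot A hxy.ne (hxy.trans hyz).ne hyz.ne)
  rw [hx, hy] at e1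
  rw [e1, hz] at e2
  have c1 : eigenvalueCount A (Set.Iio y) = 1 := by
    rw [eigenvalueCount_eq_finset A {x} (by simpa using hxy)]
    · rwa [Finset.sup_singleton]
    · intro lam hl hn
      simp only [Finset.mem_singleton] at hn
      have hl : lam < y := hl
      exact h lam (by linarith) hn hl.ne (hl.trans hyz).ne
  have c2 : ∀ S : Set ℝ, x ∈ S → y ∈ S → S ⊆ Set.Iio z → eigenvalueCount A S = 1 + 1 := by
    intro S h1 h2 h3
    rw [eigenvalueCount_eq_finset A {x, y} (by simp [h1, h2])]
    · rwa [Finset.sup_insert, Finset.sup_singleton]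
    · intro lam hl hn
      simp only [Finset.mem_insert, Finset.mem_singleton, not_or] at hn
      have hl : lam < z := h3 hl
      exact h lam hl.le hn.1 hn.2 hl.ne
  have c3 : eigenvalueCount A (Set.Iic z) = 1 + 1 + 1 := by
    rw [eigenvalueCount_eq_finset A {x, y, z} (by simp [hyz.le, (hxy.trans hyz).le])]
    · rwa [Finset.sup_insert, Finset.sup_insert, Finset.sup_singleton, ← sup_assoc]
    · intro lam hl hn
      simp only [Finset.mem_insert, Finset.mem_singleton, not_or] at hn
      exact h lam hl hn.1 hn.2.1 hn.2.2
  refine ⟨⟨?_, ?_⟩, ?_, ?_⟩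
  · rw [c1]; norm_cast
  · rw [c2 (Set.Iic y) (Set.mem_Iic.mpr hxy.le) (Set.mem_Iic.mpr le_rfl)
      fun t ht => Set.mem_Iio.mpr ((Set.mem_Iic.mp ht).trans_lt hyz)]
    norm_cast
  · rw [c2 (Set.Iio z) (Set.mem_Iio.mpr (hxy.trans hyz)) (Set.mem_Iio.mpr hyz) subset_rfl]; norm_cast
  · rw [c3]; norm_cast

lemma isNthEigenvalue_of_double {x y : ℝ} (hxy : x < y)
    (hx : Module.rank ℂ (eigenspace A x) = 1) (hy : Module.rank ℂ (eigenspace A y) = 2)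
    (h : ∀ lam ≤ y, lam ≠ x → lam ≠ y → eigenspace A lam = ⊥) :
    IsNthEigenvalue A 2 y ∧ IsNthEigenvalue A 3 y := by
  have e1 := rank_sup_of_inf_eq_bot (eigenspace_inf_eq_bot A hxy.ne)
  rw [hx, hy] at e1
  have c1 : eigenvalueCount A (Set.Iio y) = 1 := by
    rw [eigenvalueCount_eq_finset A {x} (by simpa using hxy)]
    · rwa [Finset.sup_singleton]
    · intro lam hl hn
      simp only [Finset.mem_singleton] at hn
      have hl : lam < y := hl
      exact h lam hl.le hn hl.ne
  have c2 : eigenvalueCount A (Set.Iic y) = 1 + 2 := by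
    rw [eigenvalueCount_eq_finset A {x, y} (by simp [hxy.le])]
    · rwa [Finset.sup_insert, Finset.sup_singleton]
    · intro lam hl hn
      simp only [Finset.mem_insert, Finset.mem_singleton, not_or] at hn
      exact h lam hl hn.1 hn.2
  refine ⟨⟨?_, ?_⟩, ?_, ?_⟩
  · rw [c1]; norm_cast
  · rw [c2]; norm_cast
  · rw [c1]; norm_cast
  · rw [c2]; norm_cast

end Counting

/-! ### Zeros of functions with three poles -/

section Poles

lemma inv_sub_lt_inv_sub {e x y : ℝ} (hxy : x < y) (h : y < e ∨ e < x) :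
    (e - x)⁻¹ < (e - y)⁻¹ := by
  rcases h with h | h
  · exact (inv_lt_inv₀ (by linarith) (by linarith)).mpr (by linarith)
  · exact (inv_lt_inv_of_neg (by linarith) (by linarith)).mpr (by linarith)

/-- A function with simple poles of positive weight at `p < q` has a zero in between. -/
lemma exists_zero_between {p q w v : ℝ} (hpq : p < q) (hw : 0 < w) (hv : 0 < v) {f : ℝ → ℝ}
    (hf : ContinuousOn f (Set.Icc p q)) :
    ∃ x, p < x ∧ x < q ∧ w * (p - x)⁻¹ + v * (q - x)⁻¹ + f x = 0 := by
  -- Multiplying by `(p - x) (q - x)` removes the poles. The resulting function is positive at `p`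
  -- and negative at `q`.
  have hc : ContinuousOn (fun x => w * (q - x) + v * (p - x) + (p - x) * (q - x) * f x)
      (Set.Icc p q) := by fun_prop
  have h0 : (0 : ℝ) ∈ Set.Icc (w * (q - q) + v * (p - q) + (p - q) * (q - q) * f q)
      (w * (q - p) + v * (p - p) + (p - p) * (q - p) * f p) := by
    have h1 := mul_pos hw (sub_pos.mpr hpq)
    have h2 := mul_pos hv (sub_pos.mpr hpq)
    constructor <;> nlinarith
  obtain ⟨x, ⟨h1, h2⟩, h3⟩ := intermediate_value_Icc' hpq.le hc h0
  have hp : p ≠ x := by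
    rintro rfl
    have := mul_pos hw (sub_pos.mpr hpq)
    simp only [sub_self] at h3
    linarith
  have hq : x ≠ q := by
    rintro rfl
    have := mul_pos hv (sub_pos.mpr hpq)
    simp only [sub_self] at h3
    linarith
  refine ⟨x, h1.lt_of_ne hp, h2.lt_of_ne hq, ?_⟩
  have h4 := sub_ne_zero.mpr hp
  have h5 := sub_ne_zero.mpr hq.symm
  field_simp
  linear_combination h3

lemma exists_zero_below {p l : ℝ} (hl : l < p) {f : ℝ → ℝ} {w : ℝ} (hw : 0 < w)
    (hf : ContinuousOn f (Set.Icc l p)) (h : w * (p - l)⁻¹ + f l < 0) :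
    ∃ x < p, w * (p - x)⁻¹ + f x = 0 := by
  have hc : ContinuousOn (fun x => w + (p - x) * f x) (Set.Icc l p) := by fun_prop
  have h0 : (0 : ℝ) ∈ Set.Icc (w + (p - l) * f l) (w + (p - p) * f p) := by
    have hlp := sub_pos.mpr hl
    constructor
    · have h1 := mul_neg_of_pos_of_neg hlp h
      rw [mul_add, mul_left_comm, mul_inv_cancel₀ hlp.ne', mul_one] at h1
      exact h1.le
    · simpa using hw.le
  obtain ⟨x, ⟨h1, h2⟩, h3⟩ := intermediate_value_Icc hl.le hc h0
  have hp : x ≠ p := by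
    rintro rfl
    simp at h3
    exact hw.ne' h3
  refine ⟨x, h2.lt_of_ne hp, ?_⟩
  have h5 := sub_ne_zero.mpr hp.symm
  field_simp
  linear_combination h3

/-- The sum of three simple poles and a remainder. -/
noncomputable def poleSum (e₁ e₂ e₃ : ℝ) (R : ℝ → ℝ) (x : ℝ) : ℝ :=
  (e₁ - x)⁻¹ + (e₂ - x)⁻¹ + (e₃ - x)⁻¹ + R x

variable {e₁ e₂ e₃ c : ℝ} {R : ℝ → ℝ}

lemma poleSum_lt (hR : MonotoneOn R (Set.Iio c)) {x y : ℝ} (hxy : x < y) (hy : y < c)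
    (h1 : y < e₁ ∨ e₁ < x) (h2 : y < e₂ ∨ e₂ < x) (h3 : y < e₃ ∨ e₃ < x) :
    poleSum e₁ e₂ e₃ R x < poleSum e₁ e₂ e₃ R y := by
  have := hR (show x < c from hxy.trans hy) (show y < c from hy) hxy.le
  have := inv_sub_lt_inv_sub hxy h1
  have := inv_sub_lt_inv_sub hxy h2
  have := inv_sub_lt_inv_sub hxy h3
  unfold poleSum
  linarith

lemma poleSum_zero_unique (hR : MonotoneOn R (Set.Iio c)) {x y : ℝ} (hx : x < c) (hy : y < c)
    (h1 : x < e₁ ∧ y < e₁ ∨ e₁ < x ∧ e₁ < y) (h2 : x < e₂ ∧ y < e₂ ∨ e₂ < x ∧ e₂ < y)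
    (h3 : x < e₃ ∧ y < e₃ ∨ e₃ < x ∧ e₃ < y)
    (hx0 : poleSum e₁ e₂ e₃ R x = 0) (hy0 : poleSum e₁ e₂ e₃ R y = 0) : x = y := by
  rcases lt_trichotomy x y with h | h | h
  · have := poleSum_lt (e₁ := e₁) (e₂ := e₂) (e₃ := e₃) hR h hy (by tauto) (by tauto) (by tauto)
    linarith
  · exact h
  · have := poleSum_lt (e₁ := e₁) (e₂ := e₂) (e₃ := e₃) hR h hx (by tauto) (by tauto) (by tauto)
    linarith

lemma continuousOn_inv_sub {e : ℝ} {s : Set ℝ} (h : e ∉ s) :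
    ContinuousOn (fun x => (e - x)⁻¹) s :=
  ContinuousOn.inv₀ (by fun_prop) fun x hx h0 => h (by rwa [sub_eq_zero.mp h0])

/-- Poles coinciding with `e₁` merge with it into one pole of weight `2` or `3`; the remaining ones
are continuous up to `e₁` and join the remainder. The two lemmas after this one treat the gaps in
the same way. -/
lemma exists_poleSum_zero_below (h12 : e₁ ≤ e₂) (h23 : e₂ ≤ e₃) (h3c : e₃ < c)
    (hc : ContinuousOn R (Set.Iio c)) (hl : ∃ l < e₁, poleSum e₁ e₂ e₃ R l < 0) :
    ∃ x < e₁, poleSum e₁ e₂ e₃ R x = 0 := by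
  obtain ⟨l, hl, hneg⟩ := hl
  have hRc : ContinuousOn R (Set.Icc l e₁) := hc.mono fun x hx =>
    hx.2.trans_lt (lt_of_le_of_lt (h12.trans h23) h3c)
  rcases h12.eq_or_lt with rfl | h12
  · rcases h23.eq_or_lt with rfl | h23
    · obtain ⟨x, h1, h2⟩ := exists_zero_below (w := 3) hl (by norm_num) hRc
        (by unfold poleSum at hneg; linarith)
      exact ⟨x, h1, by unfold poleSum; linarith⟩
    · obtain ⟨x, h1, h2⟩ := exists_zero_below (w := 2) hl (by norm_num)
        ((continuousOn_inv_sub (e := e₃) fun h => by linarith [h.2]).add hRc)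
        (by unfold poleSum at hneg; simp only [Pi.add_apply]; linarith)
      exact ⟨x, h1, by unfold poleSum; simp only [Pi.add_apply] at h2; linarith⟩
  · obtain ⟨x, h1, h2⟩ := exists_zero_below (w := 1) hl (by norm_num)
      (((continuousOn_inv_sub (e := e₂) fun h => by linarith [h.2]).add
        (continuousOn_inv_sub (e := e₃) fun h => by linarith [h.2])).add hRc)
      (by unfold poleSum at hneg; simp only [Pi.add_apply]; linarith)
    exact ⟨x, h1, by unfold poleSum; simp only [Pi.add_apply] at h2; linarith⟩

lemma exists_poleSum_zero_first (h12 : e₁ < e₂) (h23 : e₂ ≤ e₃) (h3c : e₃ < c)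
    (hc : ContinuousOn R (Set.Iio c)) :
    ∃ x, e₁ < x ∧ x < e₂ ∧ poleSum e₁ e₂ e₃ R x = 0 := by
  have hRc : ContinuousOn R (Set.Icc e₁ e₂) := hc.mono fun x hx =>
    hx.2.trans_lt (lt_of_le_of_lt h23 h3c)
  rcases h23.eq_or_lt with rfl | h23
  · obtain ⟨x, h1, h2, h3⟩ := exists_zero_between (w := 1) (v := 2) h12 (by norm_num)
      (by norm_num) hRc
    exact ⟨x, h1, h2, by unfold poleSum; linarith⟩
  · obtain ⟨x, h1, h2, h3⟩ := exists_zero_between (w := 1) (v := 1) h12 (by norm_num)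
      (by norm_num) ((continuousOn_inv_sub (e := e₃) fun h => by linarith [h.2]).add hRc)
    exact ⟨x, h1, h2, by unfold poleSum; simp only [Pi.add_apply] at h3; linarith⟩

lemma exists_poleSum_zero_second (h12 : e₁ ≤ e₂) (h23 : e₂ < e₃) (h3c : e₃ < c)
    (hc : ContinuousOn R (Set.Iio c)) :
    ∃ x, e₂ < x ∧ x < e₃ ∧ poleSum e₁ e₂ e₃ R x = 0 := by
  have hRc : ContinuousOn R (Set.Icc e₂ e₃) := hc.mono fun x hx => hx.2.trans_lt h3c
  rcases h12.eq_or_lt with rfl | h12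
  · obtain ⟨x, h1, h2, h3⟩ := exists_zero_between (w := 2) (v := 1) h23 (by norm_num)
      (by norm_num) hRc
    exact ⟨x, h1, h2, by unfold poleSum; linarith⟩
  · obtain ⟨x, h1, h2, h3⟩ := exists_zero_between (w := 1) (v := 1) h23 (by norm_num)
      (by norm_num) ((continuousOn_inv_sub (e := e₁) fun h => by linarith [h.1]).add hRc)
    exact ⟨x, h1, h2, by unfold poleSum; simp only [Pi.add_apply] at h3; linarith⟩

/-- The second and third eigenvalue of an operator whose eigenvalues below `c` are governed by a
secular equation with poles at `e₁ ≤ e₂ ≤ e₃`. -/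
lemma exists_isNthEigenvalue {H : Type*} [AddCommGroup H] [Module ℂ H] (A : H →ₗ.[ℂ] H)
    (h12 : e₁ ≤ e₂) (h23 : e₂ ≤ e₃) (h3c : e₃ < c)
    (hR : MonotoneOn R (Set.Iio c)) (hc : ContinuousOn R (Set.Iio c))
    (hl : ∃ l < e₁, poleSum e₁ e₂ e₃ R l < 0)
    (h0 : ∀ x < c, x ≠ e₁ → x ≠ e₂ → x ≠ e₃ → poleSum e₁ e₂ e₃ R x = 0 →
      Module.rank ℂ (eigenspace A x) = 1)
    (h0' : ∀ x < c, x ≠ e₁ → x ≠ e₂ → x ≠ e₃ → poleSum e₁ e₂ e₃ R x ≠ 0 → eigenspace A x = ⊥)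
    (hs1 : e₁ < e₂ → eigenspace A e₁ = ⊥) (hs2 : e₁ < e₂ → e₂ < e₃ → eigenspace A e₂ = ⊥)
    (hd1 : e₁ = e₂ → e₂ < e₃ → Module.rank ℂ (eigenspace A e₂) = 1)
    (hd2 : e₁ < e₂ → e₂ = e₃ → Module.rank ℂ (eigenspace A e₂) = 1)
    (ht : e₁ = e₂ → e₂ = e₃ → Module.rank ℂ (eigenspace A e₂) = 2) :
    ∃ y z, IsNthEigenvalue A 2 y ∧ IsNthEigenvalue A 3 z ∧
      (e₁ = e₂ ∧ y = e₂ ∨ e₁ < y ∧ y < e₂ ∧ poleSum e₁ e₂ e₃ R y = 0) ∧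
      (e₂ = e₃ ∧ z = e₂ ∨ e₂ < z ∧ z < e₃ ∧ poleSum e₁ e₂ e₃ R z = 0) := by
  -- This is the first eigenvalue, the only one below all three poles.
  obtain ⟨x, hx, hx0⟩ := exists_poleSum_zero_below h12 h23 h3c hc hl
  have hxr := h0 x (by linarith) (by linarith) (by linarith) (by linarith) hx0
  have below : ∀ w < e₁, w ≠ x → eigenspace A w = ⊥ := by
    intro w hw hwx
    refine h0' w (by linarith) (by linarith) (by linarith) (by linarith) fun hw0 => hwx ?_
    exact poleSum_zero_unique hR (by linarith) (by linarith) (Or.inl ⟨hw, hx⟩)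
      (Or.inl ⟨by linarith, by linarith⟩) (Or.inl ⟨by linarith, by linarith⟩) hw0 hx0
  -- A triple pole is an eigenvalue of multiplicity `2`, at once second and third. Otherwise at most
  -- two poles coincide and three simple eigenvalues `x < y < z` result.
  by_cases htriple : e₁ = e₂ ∧ e₂ = e₃
  · obtain ⟨rfl, rfl⟩ := htriple
    obtain ⟨h2, h3⟩ := isNthEigenvalue_of_double A hx hxr (ht rfl rfl)
      fun w hw hwx hwe => below w (lt_of_le_of_ne hw hwe) hwx
    exact ⟨e₁, e₁, h2, h3, Or.inl ⟨rfl, rfl⟩, Or.inl ⟨rfl, rfl⟩⟩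
  obtain ⟨y, hy, hyr⟩ : ∃ y, (e₁ = e₂ ∧ y = e₂ ∨ e₁ < y ∧ y < e₂ ∧ poleSum e₁ e₂ e₃ R y = 0) ∧
      Module.rank ℂ (eigenspace A y) = 1 := by
    rcases h12.eq_or_lt with h | h
    · exact ⟨e₂, Or.inl ⟨h, rfl⟩, hd1 h (lt_of_le_of_ne h23 fun h' => htriple ⟨h, h'⟩)⟩
    · obtain ⟨y, h1, h2, h3⟩ := exists_poleSum_zero_first h h23 h3c hc
      exact ⟨y, Or.inr ⟨h1, h2, h3⟩,
        h0 y (by linarith) (by linarith) (by linarith) (by linarith) h3⟩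
  obtain ⟨z, hz, hzr⟩ : ∃ z, (e₂ = e₃ ∧ z = e₂ ∨ e₂ < z ∧ z < e₃ ∧ poleSum e₁ e₂ e₃ R z = 0) ∧
      Module.rank ℂ (eigenspace A z) = 1 := by
    rcases h23.eq_or_lt with h | h
    · exact ⟨e₂, Or.inl ⟨h, rfl⟩, hd2 (lt_of_le_of_ne h12 fun h' => htriple ⟨h', h⟩) h⟩
    · obtain ⟨z, h1, h2, h3⟩ := exists_poleSum_zero_second h12 h h3c hc
      exact ⟨z, Or.inr ⟨h1, h2, h3⟩,
        h0 z (by linarith) (by linarith) (by linarith) (by linarith) h3⟩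
  have hxy : x < y := by rcases hy with ⟨h, rfl⟩ | ⟨h, -⟩ <;> linarith
  have hyz : y < z := by
    rcases hy with ⟨h, rfl⟩ | ⟨h, h', -⟩ <;> rcases hz with ⟨h1, rfl⟩ | ⟨h1, -⟩
    · exact absurd ⟨h, h1⟩ htriple
    all_goals linarith
  have hze : z ≤ e₃ := by rcases hz with ⟨h, rfl⟩ | ⟨-, h, -⟩ <;> linarith
  obtain ⟨h2, h3⟩ := isNthEigenvalue_of_simple A hxy hyz hxr hyr hzr (by
    intro w hwz hwx hwy hwz'
    rcases lt_trichotomy w e₁ with h | rfl | h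
    · exact below w h hwx
    · refine hs1 (lt_of_le_of_ne h12 ?_)
      rintro rfl
      rcases hy with ⟨-, h⟩ | ⟨h, h', -⟩
      · exact hwy h.symm
      · linarith
    rcases lt_trichotomy w e₂ with h' | rfl | h'
    · refine h0' w (by linarith) (by linarith) (by linarith) (by linarith) fun hw0 => hwy ?_
      rcases hy with ⟨h1, -⟩ | ⟨h1, h1', hy0⟩
      · linarith
      exact poleSum_zero_unique hR (by linarith) (by linarith) (Or.inr ⟨h, h1⟩)
        (Or.inl ⟨h', h1'⟩) (Or.inl ⟨by linarith, by linarith⟩) hw0 hy0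
    · refine hs2 h (lt_of_le_of_ne h23 ?_)
      rintro rfl
      rcases hz with ⟨-, h⟩ | ⟨h, h', -⟩
      · exact hwz' h.symm
      · linarith
    · have hzs : e₂ < z ∧ z < e₃ ∧ poleSum e₁ e₂ e₃ R z = 0 := by
        rcases hz with ⟨-, rfl⟩ | h1
        · linarith
        · exact h1
      obtain ⟨h1, h1', hz0⟩ := hzs
      refine h0' w (by linarith) (by linarith) (by linarith) (by linarith) fun hw0 => hwz' ?_
      exact poleSum_zero_unique hR (by linarith) (by linarith)
        (Or.inr ⟨by linarith, by linarith⟩)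
        (Or.inr ⟨h', h1⟩) (Or.inl ⟨by linarith, by linarith⟩) hw0 hz0)
  exact ⟨y, z, h2, h3, hy, hz⟩

end Poles

/-! ### The dual lattice seen from the Dirac point -/

section Dirac

variable {a : ℝ}

/-- The indices of the three dual lattice points closest to `-K`. -/
def diracTriple : Finset (ℤ × ℤ) := {(0, 0), (-1, 0), (-1, -1)}

lemma norm_diracPoint_sq (ha : 0 < a) : ‖diracPoint a‖ ^ 2 = (4 * Real.pi / (3 * a)) ^ 2 := by
  rw [diracPoint, norm_sq_comb ha]
  field_simp
  norm_num

lemma norm_diracPoint (ha : 0 < a) : ‖diracPoint a‖ = 4 * Real.pi / (3 * a) := by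
  have := Real.pi_pos
  exact (pow_left_inj₀ (norm_nonneg _) (by positivity) two_ne_zero).mp (norm_diracPoint_sq ha)

lemma norm_diracPoint_pos (ha : 0 < a) : 0 < ‖diracPoint a‖ := by
  have := Real.pi_pos
  rw [norm_diracPoint ha]
  positivity

/-- With coordinates `m₁ + 2/3` and `m₂ + 1/3` the quadratic form equals an integer plus `1/3`. The
smallest value of the norm is therefore `‖K‖`, and the next possible one is `2‖K‖`. -/
lemma norm_dualVec_add_diracPoint_sq (ha : 0 < a) (m : ℤ × ℤ) :
    ‖dualVec a m + diracPoint a‖ ^ 2 = ‖diracPoint a‖ ^ 2 *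
      (3 * ((m.1 ^ 2 + m.2 ^ 2 - m.1 * m.2 + m.1 : ℤ) : ℝ) + 1) := by
  have e : dualVec a m + diracPoint a = ((m.1 : ℝ) + 2 / 3) • k₁ a + ((m.2 : ℝ) + 1 / 3) • k₂ a := by
    rw [dualVec, diracPoint]
    module
  rw [e, norm_sq_comb ha, norm_diracPoint_sq ha]
  push_cast
  field_simp
  ring

lemma norm_sq_of_mem_diracTriple (ha : 0 < a) {m : ℤ × ℤ} (hm : m ∈ diracTriple) :
    ‖dualVec a m + diracPoint a‖ ^ 2 = ‖diracPoint a‖ ^ 2 := by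
  rw [norm_dualVec_add_diracPoint_sq ha]
  simp only [diracTriple, Finset.mem_insert, Finset.mem_singleton] at hm
  rcases hm with rfl | rfl | rfl <;> norm_num

/-- For `m = (x, y)` and `n` the right side, `12 n = 3 (2y - x)² + (3x + 2)² - 4`, so `n ≤ 0` leaves
only `x = 0` and `x = -1`. -/
lemma one_le_of_notMem_diracTriple {m : ℤ × ℤ} (hm : m ∉ diracTriple) :
    1 ≤ m.1 ^ 2 + m.2 ^ 2 - m.1 * m.2 + m.1 := by
  by_contra! h
  apply hm
  obtain ⟨x, y⟩ := m
  simp only at h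
  have h1 : x ≤ 0 := by nlinarith [sq_nonneg (2 * y - x), sq_nonneg (3 * x + 2)]
  have h2 : -1 ≤ x := by nlinarith [sq_nonneg (2 * y - x), sq_nonneg (3 * x + 2)]
  have h3 : x = 0 ∨ x = -1 := by omega
  rcases h3 with rfl | rfl
  · have : y = 0 := by nlinarith
    subst this
    simp [diracTriple]
  · have h4 : y ≤ 0 := by nlinarith
    have h5 : -1 ≤ y := by nlinarith
    have h6 : y = 0 ∨ y = -1 := by omega
    rcases h6 with rfl | rfl <;> simp [diracTriple]

lemma two_mul_norm_le_of_notMem (ha : 0 < a) {m : ℤ × ℤ} (hm : m ∉ diracTriple) :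
    2 * ‖diracPoint a‖ ≤ ‖dualVec a m + diracPoint a‖ := by
  apply le_of_sq_le_sq _ (norm_nonneg _)
  rw [norm_dualVec_add_diracPoint_sq ha, mul_pow, mul_comm]
  have h : (1 : ℝ) ≤ ((m.1 ^ 2 + m.2 ^ 2 - m.1 * m.2 + m.1 : ℤ) : ℝ) := by
    exact_mod_cast one_le_of_notMem_diracTriple hm
  gcongr
  linarith

variable {k : Plane}

/-- The radius `‖K‖ / 4` is chosen so that `(2 - 1/4)² = 49/16 ≥ 3` here and `(1 + 1/4)² = 25/16 <
2` for the triple; the level `2‖K‖²` then separates the triple from the rest. -/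
lemma freeEigenvalue_ge_of_notMem (ha : 0 < a) (hk : ‖k - diracPoint a‖ ≤ ‖diracPoint a‖ / 4)
    {m : ℤ × ℤ} (hm : m ∉ diracTriple) : 3 * ‖diracPoint a‖ ^ 2 ≤ freeEigenvalue a k m := by
  have h1 := two_mul_norm_le_of_notMem ha hm
  have h2 : ‖dualVec a m + diracPoint a‖ ≤ ‖dualVec a m + k‖ + ‖k - diracPoint a‖ := by
    have e : dualVec a m + diracPoint a = (dualVec a m + k) - (k - diracPoint a) := by abel
    rw [e]
    exact norm_sub_le _ _
  have h0 := norm_nonneg (diracPoint a)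
  have h3 : 7 / 4 * ‖diracPoint a‖ ≤ ‖dualVec a m + k‖ := by linarith
  have h4 := pow_le_pow_left₀ (by positivity) h3 2
  rw [freeEigenvalue]
  nlinarith [sq_nonneg ‖diracPoint a‖]

lemma freeEigenvalue_lt_of_mem (ha : 0 < a) (hk : ‖k - diracPoint a‖ ≤ ‖diracPoint a‖ / 4)
    {m : ℤ × ℤ} (hm : m ∈ diracTriple) : freeEigenvalue a k m < 2 * ‖diracPoint a‖ ^ 2 := by
  have h1 : ‖dualVec a m + diracPoint a‖ = ‖diracPoint a‖ :=
    (pow_left_inj₀ (norm_nonneg _) (norm_nonneg _) two_ne_zero).mp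
      (norm_sq_of_mem_diracTriple ha hm)
  have h2 : ‖dualVec a m + k‖ ≤ ‖dualVec a m + diracPoint a‖ + ‖k - diracPoint a‖ := by
    have e : dualVec a m + k = (dualVec a m + diracPoint a) + (k - diracPoint a) := by abel
    rw [e]
    exact norm_add_le _ _
  have h0 := norm_diracPoint_pos ha
  have h3 : ‖dualVec a m + k‖ ≤ 5 / 4 * ‖diracPoint a‖ := by linarith
  have h4 := pow_le_pow_left₀ (norm_nonneg _) h3 2
  rw [freeEigenvalue]
  nlinarith

/-- The first order splitting of the triple free eigenvalue. -/
noncomputable def splitting (a : ℝ) (k : Plane) (m : ℤ × ℤ) : ℝ :=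
  2 * inner ℝ (dualVec a m + diracPoint a) (k - diracPoint a)

lemma freeEigenvalue_of_mem (ha : 0 < a) (k : Plane) {m : ℤ × ℤ} (hm : m ∈ diracTriple) :
    freeEigenvalue a k m = ‖diracPoint a‖ ^ 2 + ‖k - diracPoint a‖ ^ 2 + splitting a k m := by
  have e : dualVec a m + k = (dualVec a m + diracPoint a) + (k - diracPoint a) := by abel
  rw [freeEigenvalue, e, norm_add_sq_real, norm_sq_of_mem_diracTriple ha hm, splitting]
  ring

lemma sum_diracTriple (f : ℤ × ℤ → ℝ) :
    ∑ m ∈ diracTriple, f m = f (0, 0) + (f (-1, 0) + f (-1, -1)) := by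
  rw [diracTriple, Finset.sum_insert (by simp), Finset.sum_insert (by simp), Finset.sum_singleton]

/-- The three vectors `ξ_m + K` are the vertices of an equilateral triangle centred at the origin
and sum to zero. -/
lemma sum_splitting (a : ℝ) (k : Plane) : ∑ m ∈ diracTriple, splitting a k m = 0 := by
  rw [sum_diracTriple]
  simp only [splitting, dualVec, diracPoint, inner_add_left, real_inner_smul_left]
  push_cast
  ring

/-- Three vectors of length `‖K‖` at mutual angles of 120° form a tight frame: the squares of their
inner products with `x` sum to `(3/2) ‖K‖² ‖x‖²`. This makes the cone isotropic. -/
lemma sum_splitting_sq (ha : 0 < a) (k : Plane) :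
    ∑ m ∈ diracTriple, splitting a k m ^ 2 = 6 * (‖diracPoint a‖ * ‖k - diracPoint a‖) ^ 2 := by
  have h3 : (√3) ^ 2 = 3 := Real.sq_sqrt (by norm_num)
  have h0 : 0 < √3 := by positivity
  rw [sum_diracTriple, mul_pow, norm_diracPoint_sq ha]
  unfold splitting
  generalize k - diracPoint a = x
  have e1 : inner ℝ (k₁ a) x = 4 * Real.pi / (a * √3) * (x 0 / 2 + √3 / 2 * x 1) := by
    simp [k₁, PiLp.inner_apply, Fin.sum_univ_two]
    ring
  have e2 : inner ℝ (k₂ a) x = 4 * Real.pi / (a * √3) * (x 0 / 2 - √3 / 2 * x 1) := by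
    simp [k₂, PiLp.inner_apply, Fin.sum_univ_two]
    ring
  have e3 : ‖x‖ ^ 2 = x 0 ^ 2 + x 1 ^ 2 := by
    simp [EuclideanSpace.norm_sq_eq, Fin.sum_univ_two]
  simp only [inner_add_left, real_inner_smul_left, dualVec, diracPoint, e1, e2, e3]
  push_cast
  field_simp
  ring_nf
  rw [h3]
  ring

end Dirac

/-! ### The remainder in the secular equation -/

section Remainder

variable {a α : ℝ} {k : Plane}

/-- The contribution of a dual lattice point away from the Dirac triple. -/
noncomputable def farTerm (a : ℝ) (k : Plane) (x : ℝ) (m : ℤ × ℤ) : ℝ :=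
  if m ∈ diracTriple then 0 else (freeEigenvalue a k m - x)⁻¹ - (freeEigenvalue a k m + 1)⁻¹

/-- The regular part of `area(Γ) (g_x(0, k) - α)` near the Dirac point. -/
noncomputable def remainder (a α : ℝ) (k : Plane) (x : ℝ) : ℝ :=
  greenConst a k - areaΓ a * α - ∑ m ∈ diracTriple, (freeEigenvalue a k m + 1)⁻¹ +
    ∑' m, farTerm a k x m

/-- With `N = ‖K‖²`, the bounds `E ≥ 3N` and `x ≤ 2N` give `E ≤ 3 (E - x)` and `1 ≤ (E - x) / N`;
their sum is the stated comparison. -/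
lemma inv_freeEigenvalue_sub_le (ha : 0 < a) (hk : ‖k - diracPoint a‖ ≤ ‖diracPoint a‖ / 4)
    {x : ℝ} (hx : x ≤ 2 * ‖diracPoint a‖ ^ 2) {m : ℤ × ℤ} (hm : m ∉ diracTriple) :
    0 < freeEigenvalue a k m - x ∧ (freeEigenvalue a k m - x)⁻¹ ≤
      (3 + (‖diracPoint a‖ ^ 2)⁻¹) * (freeEigenvalue a k m + 1)⁻¹ := by
  have h1 := freeEigenvalue_ge_of_notMem ha hk hm
  have h2 := freeEigenvalue_nonneg a k m
  have h0 : 0 < ‖diracPoint a‖ ^ 2 := pow_pos (norm_diracPoint_pos ha) 2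
  generalize ‖diracPoint a‖ ^ 2 = N at *
  generalize freeEigenvalue a k m = E at *
  have h3 : 0 < E - x := by linarith
  refine ⟨h3, ?_⟩
  rw [← div_eq_mul_inv, inv_le_comm₀ h3 (by positivity), inv_div, div_le_iff₀ (by positivity)]
  have h4 : N ≤ E - x := by linarith
  have h5 : 1 ≤ (E - x) * N⁻¹ := by
    rw [← div_eq_mul_inv, le_div_iff₀ h0]; linarith
  linarith

lemma abs_farTerm_le (ha : 0 < a) (hk : ‖k - diracPoint a‖ ≤ ‖diracPoint a‖ / 4)
    {x : ℝ} (hx : x ≤ 2 * ‖diracPoint a‖ ^ 2) (m : ℤ × ℤ) :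
    |farTerm a k x m| ≤ |x + 1| * (3 + (‖diracPoint a‖ ^ 2)⁻¹) *
      ((freeEigenvalue a k m + 1) ^ 2)⁻¹ := by
  have h2 := freeEigenvalue_nonneg a k m
  unfold farTerm
  split_ifs with hm
  · rw [abs_zero]; positivity
  · obtain ⟨h3, h4⟩ := inv_freeEigenvalue_sub_le ha hk hx hm
    rw [inv_sub_inv_eq (sub_pos.mp h3).ne' h2, abs_mul, abs_of_pos (by positivity :
      0 < (freeEigenvalue a k m - x)⁻¹ * (freeEigenvalue a k m + 1)⁻¹), mul_assoc]
    refine mul_le_mul_of_nonneg_left ?_ (abs_nonneg _)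
    rw [sq (freeEigenvalue a k m + 1), mul_inv, ← mul_assoc]
    exact mul_le_mul_of_nonneg_right h4 (by positivity)

lemma summable_farTerm (ha : 0 < a) (hk : ‖k - diracPoint a‖ ≤ ‖diracPoint a‖ / 4)
    {x : ℝ} (hx : x ≤ 2 * ‖diracPoint a‖ ^ 2) : Summable (farTerm a k x) :=
  Summable.of_norm_bounded ((summable_inv_sq ha k).mul_left _) (abs_farTerm_le ha hk hx)

/-- Away from the triple `b = 1 / ((E - x) (E - y))`. Its sign makes the remainder monotone, and its
summable bound makes it Lipschitz. -/
lemma farTerm_sub (ha : 0 < a) (hk : ‖k - diracPoint a‖ ≤ ‖diracPoint a‖ / 4)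
    {x y : ℝ} (hx : x ≤ 2 * ‖diracPoint a‖ ^ 2) (hy : y ≤ 2 * ‖diracPoint a‖ ^ 2) (m : ℤ × ℤ) :
    ∃ b, farTerm a k y m - farTerm a k x m = (y - x) * b ∧ 0 ≤ b ∧
      b ≤ (3 + (‖diracPoint a‖ ^ 2)⁻¹) ^ 2 * ((freeEigenvalue a k m + 1) ^ 2)⁻¹ := by
  have h2 := freeEigenvalue_nonneg a k m
  unfold farTerm
  split_ifs with hm
  · exact ⟨0, by simp, le_rfl, by positivity⟩
  · obtain ⟨h3, h4⟩ := inv_freeEigenvalue_sub_le ha hk hx hm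
    obtain ⟨h5, h6⟩ := inv_freeEigenvalue_sub_le ha hk hy hm
    refine ⟨(freeEigenvalue a k m - x)⁻¹ * (freeEigenvalue a k m - y)⁻¹, ?_, by positivity, ?_⟩
    · field_simp
      ring
    · rw [← inv_pow (freeEigenvalue a k m + 1), ← mul_pow, sq (_ * _)]
      gcongr

lemma monotoneOn_remainder (ha : 0 < a) (α : ℝ)
    (hk : ‖k - diracPoint a‖ ≤ ‖diracPoint a‖ / 4) :
    MonotoneOn (remainder a α k) (Set.Iio (2 * ‖diracPoint a‖ ^ 2)) := by
  intro x hx y hy hxy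
  have hx := (Set.mem_Iio.mp hx).le
  have hy := (Set.mem_Iio.mp hy).le
  unfold remainder
  gcongr 1
  refine (summable_farTerm ha hk hx).tsum_le_tsum (fun m => ?_) (summable_farTerm ha hk hy)
  obtain ⟨b, h1, h2, -⟩ := farTerm_sub ha hk hx hy m
  have := mul_nonneg (sub_nonneg.mpr hxy) h2
  linarith

lemma continuousOn_remainder (ha : 0 < a) (α : ℝ)
    (hk : ‖k - diracPoint a‖ ≤ ‖diracPoint a‖ / 4) :
    ContinuousOn (remainder a α k) (Set.Iio (2 * ‖diracPoint a‖ ^ 2)) := by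
  have hS := (summable_inv_sq ha k).mul_left ((3 + (‖diracPoint a‖ ^ 2)⁻¹) ^ 2)
  have hS0 : 0 ≤ ∑' m, (3 + (‖diracPoint a‖ ^ 2)⁻¹) ^ 2 * ((freeEigenvalue a k m + 1) ^ 2)⁻¹ :=
    tsum_nonneg fun m => by positivity
  refine (LipschitzOnWith.of_dist_le_mul (K := ⟨_, hS0⟩) fun x hx y hy => ?_).continuousOn
  have hx := (Set.mem_Iio.mp hx).le
  have hy := (Set.mem_Iio.mp hy).le
  have h1 : remainder a α k x - remainder a α k y = ∑' m, (farTerm a k x m - farTerm a k y m) := by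
    rw [(summable_farTerm ha hk hx).tsum_sub (summable_farTerm ha hk hy)]
    unfold remainder
    ring
  rw [Real.dist_eq, Real.dist_eq, h1, mul_comm]
  refine tsum_of_norm_bounded (f := fun m => farTerm a k x m - farTerm a k y m)
    (hS.hasSum.mul_left |x - y|) fun m => ?_
  obtain ⟨b, h2, h3, h4⟩ := farTerm_sub ha hk hy hx m
  rw [h2, Real.norm_eq_abs, abs_mul, abs_of_nonneg h3]
  gcongr

/-- The independence of `M` from `k` is what makes the error in the asymptotics uniform in the
direction of `k - K`. -/
lemma exists_abs_remainder_le (ha : 0 < a) (α : ℝ) : ∃ M, ∀ k : Plane,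
    ‖k - diracPoint a‖ ≤ ‖diracPoint a‖ / 4 → ∀ x, 0 ≤ x → x ≤ 2 * ‖diracPoint a‖ ^ 2 →
      |remainder a α k x| ≤ M := by
  have hA := areaΓ_pos ha
  have hd := cellDiam_nonneg a
  have hD : 0 ≤ ∑' m, decay a m := tsum_nonneg (decay_nonneg a)
  set N := ‖diracPoint a‖ with hN
  have hN0 : 0 < N := norm_diracPoint_pos ha
  refine ⟨8 * cellDiam a * (1 + cellDiam a) ^ 2 * (1 + 2 * N) ^ 3 * ∑' m, decay a m
    + areaΓ a * |α| + 3 + (2 * N ^ 2 + 1) * (3 + (N ^ 2)⁻¹) *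
      (4 * (1 + 2 * N) ^ 3 * ∑' m, decay a m), ?_⟩
  intro k hk x hx0 hx
  have hkN : ‖k‖ ≤ 2 * N := by
    have := norm_sub_norm_le k (diracPoint a)
    linarith
  have h1 : |greenConst a k| ≤
      8 * cellDiam a * (1 + cellDiam a) ^ 2 * (1 + 2 * N) ^ 3 * ∑' m, decay a m := by
    refine (abs_greenConst_le ha k).trans ?_
    gcongr
  have h2 : |∑ m ∈ diracTriple, (freeEigenvalue a k m + 1)⁻¹| ≤ 3 := by
    refine (Finset.abs_sum_le_sum_abs _ _).trans ?_
    have h3 : ∀ m, |(freeEigenvalue a k m + 1)⁻¹| ≤ 1 := fun m => by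
      have := freeEigenvalue_nonneg a k m
      rw [abs_of_nonneg (by positivity)]
      exact inv_le_one_of_one_le₀ (by linarith)
    rw [sum_diracTriple fun m => |(freeEigenvalue a k m + 1)⁻¹|]
    linarith [h3 (0, 0), h3 (-1, 0), h3 (-1, -1)]
  have h4 : |∑' m, farTerm a k x m| ≤ (2 * N ^ 2 + 1) * (3 + (N ^ 2)⁻¹) *
      (4 * (1 + 2 * N) ^ 3 * ∑' m, decay a m) := by
    refine tsum_of_norm_bounded (f := farTerm a k x)
      (((summable_decay ha).hasSum.mul_left _).mul_left _) fun m => ?_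
    refine (abs_farTerm_le ha hk hx m).trans ?_
    have h5 := inv_freeEigenvalue_add_one_sq_le a k m
    have h6 := decay_nonneg a m
    rw [abs_of_nonneg (by linarith)]
    calc _ ≤ (2 * N ^ 2 + 1) * (3 + (N ^ 2)⁻¹) * (4 * (1 + ‖k‖) ^ 3 * decay a m) := by
          gcongr
      _ ≤ _ := by gcongr
  have h7 : |areaΓ a * α| = areaΓ a * |α| := by rw [abs_mul, abs_of_pos hA]
  unfold remainder
  refine (abs_add_le _ _).trans (add_le_add ((abs_sub _ _).trans (add_le_add
    ((abs_sub _ _).trans (add_le_add h1 h7.le)) h2)) h4)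

lemma freeEigenvalue_ne (ha : 0 < a) (hk : ‖k - diracPoint a‖ ≤ ‖diracPoint a‖ / 4) {x : ℝ}
    (hx : x < 2 * ‖diracPoint a‖ ^ 2) (h : ∀ m ∈ diracTriple, freeEigenvalue a k m ≠ x)
    (m : ℤ × ℤ) : freeEigenvalue a k m ≠ x := by
  by_cases hm : m ∈ diracTriple
  · exact h m hm
  · have := freeEigenvalue_ge_of_notMem ha hk hm
    have := sq_nonneg ‖diracPoint a‖
    intro h
    linarith

/-- The secular equation near the Dirac point. -/
lemma secular_eq (ha : 0 < a) (α : ℝ) (hk : ‖k - diracPoint a‖ ≤ ‖diracPoint a‖ / 4) {x : ℝ}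
    (hx : x < 2 * ‖diracPoint a‖ ^ 2) (h : ∀ m ∈ diracTriple, freeEigenvalue a k m ≠ x) :
    areaΓ a * (greenDiag a k x - α) =
      ∑ m ∈ diracTriple, (freeEigenvalue a k m - x)⁻¹ + remainder a α k x := by
  have h1 := freeEigenvalue_ne ha hk hx h
  have h2 : HasSum (fun m => if m ∈ diracTriple then
      (freeEigenvalue a k m - x)⁻¹ - (freeEigenvalue a k m + 1)⁻¹ else 0)
      (∑ m ∈ diracTriple, ((freeEigenvalue a k m - x)⁻¹ - (freeEigenvalue a k m + 1)⁻¹)) := by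
    have h0 : HasSum (fun m => if m ∈ diracTriple then
        (freeEigenvalue a k m - x)⁻¹ - (freeEigenvalue a k m + 1)⁻¹ else 0) _ :=
      hasSum_sum_of_ne_finset_zero (s := diracTriple) fun m hm => by simp [hm]
    rwa [Finset.sum_congr rfl fun m hm => if_pos hm] at h0
  have h3 := h2.add (summable_farTerm ha hk hx.le).hasSum
  have h4 : ∀ m, (if m ∈ diracTriple then
      (freeEigenvalue a k m - x)⁻¹ - (freeEigenvalue a k m + 1)⁻¹ else 0) + farTerm a k x m =
      (freeEigenvalue a k m - x)⁻¹ - (freeEigenvalue a k m + 1)⁻¹ := by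
    intro m
    unfold farTerm
    split_ifs <;> simp
  simp only [h4] at h3
  rw [mul_sub, areaΓ_mul_greenDiag ha k h1, h3.tsum_eq, remainder, Finset.sum_sub_distrib]
  ring

end Remainder

/-! ### Asymptotics of the zeros -/

section Asymptotics

/-- Since `∑_{i<j} d_i d_j = -3 s²`, clearing denominators gives `3 (t - s) (t + s) = -ρ ∏ (d_j -
t)`. All `|d_j| ≤ 2s`, so the product is at most `(4s)³`. Once `t < s / 2`, division by `3 (s - t) ≥
3s / 2` yields `(128/3) M s²`, rounded up to `43 M s²`. If `d₁ = d₂`, then `t = -s` exactly. -/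
lemma first_zero_near {d₁ d₂ d₃ s t M ρ : ℝ} (h12 : d₁ ≤ d₂) (h23 : d₂ ≤ d₃)
    (hsum : d₁ + d₂ + d₃ = 0) (hsq : d₁ ^ 2 + d₂ ^ 2 + d₃ ^ 2 = 6 * s ^ 2) (hs : 0 ≤ s)
    (hM : M * s ≤ 1 / 2) (hρ : |ρ| ≤ M)
    (ht : d₁ = d₂ ∧ t = d₂ ∨ d₁ < t ∧ t < d₂ ∧ (d₁ - t)⁻¹ + (d₂ - t)⁻¹ + (d₃ - t)⁻¹ + ρ = 0) :
    |t + s| ≤ 43 * M * s ^ 2 := by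
  have hM0 : 0 ≤ M := (abs_nonneg ρ).trans hρ
  rcases ht with ⟨rfl, rfl⟩ | ⟨h1, h2, h3⟩
  · have h4 : d₃ = -2 * t := by linarith
    subst h4
    have h5 : (-t) ^ 2 = s ^ 2 := by linarith
    have h6 : -t = s := (pow_left_inj₀ (by linarith) hs two_ne_zero).mp h5
    rw [← h6]
    simp
    positivity
  · have hd : ∀ {x y z : ℝ}, x + y + z = 0 → x ^ 2 + y ^ 2 + z ^ 2 = 6 * s ^ 2 → |x| ≤ 2 * s := by
      intro x y z hxyz hq
      apply abs_le_of_sq_le_sq _ (by positivity)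
      obtain rfl : x = -y - z := by linarith
      nlinarith [sq_nonneg (y - z)]
    have b1 := abs_le.mp (hd hsum hsq)
    have b2 := abs_le.mp (hd (x := d₂) (y := d₁) (z := d₃) (by linarith) (by linarith))
    have b3 := abs_le.mp (hd (x := d₃) (y := d₁) (z := d₂) (by linarith) (by linarith))
    have hs0 : 0 < s := by
      rcases hs.eq_or_lt with rfl | hs
      · linarith
      · exact hs
    have n1 : d₁ - t ≠ 0 := by linarith
    have n2 : d₂ - t ≠ 0 := by linarith
    have n3 : d₃ - t ≠ 0 := by linarith
    have hpoly : 3 * (t - s) * (t + s) = -ρ * ((d₁ - t) * (d₂ - t) * (d₃ - t)) := by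
      field_simp at h3
      obtain rfl : d₃ = -d₁ - d₂ := by linarith
      linear_combination h3 + hsq / 2
    -- This excludes the root near `+s`. If `t ≥ s / 2`, then `d₂, d₃ > s / 2` and hence `d₁ < -s`;
    -- the three inverses then add up to at least `2 / (3s)`, which forces `M s ≥ 2/3`.
    have hts : t < s / 2 := by
      by_contra! hts
      have i2 : 2 / (3 * s) ≤ (d₂ - t)⁻¹ := by
        rw [le_inv_comm₀ (by positivity) (by linarith), inv_div]
        linarith
      have i3 : 2 / (3 * s) ≤ (d₃ - t)⁻¹ := by
        rw [le_inv_comm₀ (by positivity) (by linarith), inv_div]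
        linarith
      have i1 : -(d₁ - t)⁻¹ ≤ 2 / (3 * s) := by
        rw [← inv_neg, inv_le_comm₀ (by linarith) (by positivity), inv_div]
        linarith
      have i4 : 2 / (3 * s) ≤ M := by linarith [(abs_le.mp hρ).1]
      rw [div_le_iff₀ (by positivity)] at i4
      linarith
    have hP : |(d₁ - t) * (d₂ - t) * (d₃ - t)| ≤ 4 * s * (4 * s) * (4 * s) := by
      rw [abs_mul, abs_mul]
      gcongr <;> rw [abs_le] <;> constructor <;> linarith
    have h4 : 3 * (s - t) * |t + s| ≤ M * (4 * s * (4 * s) * (4 * s)) := by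
      have h5 : |3 * (t - s) * (t + s)| = 3 * (s - t) * |t + s| := by
        rw [abs_mul, abs_of_neg (by linarith : 3 * (t - s) < 0)]
        ring
      rw [← h5, hpoly, abs_mul, abs_neg]
      gcongr
    have h6 : s * (3 / 2 * |t + s|) ≤ s * (64 * M * s ^ 2) := by
      have : 3 * (s / 2) * |t + s| ≤ 3 * (s - t) * |t + s| := by
        gcongr
        linarith
      linarith
    have h7 := le_of_mul_le_mul_left h6 hs0
    have : 0 ≤ M * s ^ 2 := by positivity
    linarith

/-- The reflection `d ↦ -d`, `t ↦ -t`, `ρ ↦ -ρ` exchanges the two gaps. -/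
lemma second_zero_near {d₁ d₂ d₃ s t M ρ : ℝ} (h12 : d₁ ≤ d₂) (h23 : d₂ ≤ d₃)
    (hsum : d₁ + d₂ + d₃ = 0) (hsq : d₁ ^ 2 + d₂ ^ 2 + d₃ ^ 2 = 6 * s ^ 2) (hs : 0 ≤ s)
    (hM : M * s ≤ 1 / 2) (hρ : |ρ| ≤ M)
    (ht : d₂ = d₃ ∧ t = d₂ ∨ d₂ < t ∧ t < d₃ ∧ (d₁ - t)⁻¹ + (d₂ - t)⁻¹ + (d₃ - t)⁻¹ + ρ = 0) :
    |t - s| ≤ 43 * M * s ^ 2 := by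
  have h := first_zero_near (d₁ := -d₃) (d₂ := -d₂) (d₃ := -d₁) (t := -t) (ρ := -ρ) (s := s)
    (M := M) (by linarith) (by linarith) (by linarith) (by linarith) hs hM (by rwa [abs_neg]) ?_
  · rwa [← abs_neg, neg_sub, sub_eq_neg_add]
  · rcases ht with ⟨h1, h2⟩ | ⟨h1, h2, h3⟩
    · left; constructor <;> linarith
    · refine Or.inr ⟨by linarith, by linarith, ?_⟩
      have e : ∀ d : ℝ, (-d - -t)⁻¹ = -(d - t)⁻¹ := fun d => by rw [← inv_neg]; congr 1; ring
      rw [e, e, e]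
      linarith

end Asymptotics

/-! ### The second and third band near the Dirac point -/

section Bands

lemma exists_sorted {ι : Type*} [DecidableEq ι] (f : ι → ℝ) {p q r : ι} (hpq : p ≠ q) (hpr : p ≠ r)
    (hqr : q ≠ r) : ∃ x y z, x ≠ y ∧ x ≠ z ∧ y ≠ z ∧ ({p, q, r} : Finset ι) = {x, y, z} ∧
      f x ≤ f y ∧ f y ≤ f z := by
  rcases le_total (f p) (f q) with h1 | h1 <;> rcases le_total (f q) (f r) with h2 | h2 <;>
    rcases le_total (f p) (f r) with h3 | h3
  · exact ⟨p, q, r, hpq, hpr, hqr, rfl, h1, h2⟩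
  · exact ⟨p, q, r, hpq, hpr, hqr, rfl, h1, h2⟩
  · exact ⟨p, r, q, hpr, hpq, hqr.symm, by grind, h3, h2⟩
  · exact ⟨r, p, q, hpr.symm, hqr.symm, hpq, by grind, h3, h1⟩
  · exact ⟨q, p, r, hpq.symm, hqr, hpr, by grind, h1, h3⟩
  · exact ⟨q, r, p, hqr, hpq.symm, hpr.symm, by grind, h2, h3⟩
  · exact ⟨r, q, p, hqr.symm, hpr.symm, hpq.symm, by grind, h2, h1⟩
  · exact ⟨r, q, p, hqr.symm, hpr.symm, hpq.symm, by grind, h2, h1⟩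

variable {a α : ℝ} {k : Plane}

lemma rank_eigenspace_diracTriple (ha : 0 < a) (α : ℝ)
    (hk : ‖k - diracPoint a‖ ≤ ‖diracPoint a‖ / 4) {mu : ℝ} {N : Finset (ℤ × ℤ)}
    (hN : N.Nonempty) (hNT : N ⊆ diracTriple)
    (h : ∀ m ∈ diracTriple, m ∈ N ↔ freeEigenvalue a k m = mu) :
    Module.rank ℂ (eigenspace (scatterer a α k) mu) = (N.card - 1 : ℕ) := by
  refine rank_eigenspace_free ha α k hN fun m => ?_
  by_cases hm : m ∈ diracTriple
  · exact h m hm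
  · refine iff_of_false (fun h' => hm (hNT h')) fun h' => ?_
    obtain ⟨n, hn⟩ := hN
    have h1 := freeEigenvalue_ge_of_notMem ha hk hm
    have h2 := freeEigenvalue_lt_of_mem ha hk (hNT hn)
    rw [(h n (hNT hn)).mp hn] at h2
    have := sq_nonneg ‖diracPoint a‖
    linarith

/-- The eigenvalues near the Dirac point in terms of the secular equation. -/
lemma exists_isNthEigenvalue_scatterer (ha : 0 < a) (α : ℝ)
    (hk : ‖k - diracPoint a‖ ≤ ‖diracPoint a‖ / 4) {p q r : ℤ × ℤ} (hpq : p ≠ q) (hpr : p ≠ r)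
    (hqr : q ≠ r) (hT : diracTriple = {p, q, r}) {e₁ e₂ e₃ : ℝ} (h1 : freeEigenvalue a k p = e₁)
    (h2 : freeEigenvalue a k q = e₂) (h3 : freeEigenvalue a k r = e₃)
    (h12 : e₁ ≤ e₂) (h23 : e₂ ≤ e₃) :
    ∃ y z, IsNthEigenvalue (scatterer a α k) 2 y ∧ IsNthEigenvalue (scatterer a α k) 3 z ∧
      (e₁ = e₂ ∧ y = e₂ ∨ e₁ < y ∧ y < e₂ ∧ poleSum e₁ e₂ e₃ (remainder a α k) y = 0) ∧
      (e₂ = e₃ ∧ z = e₂ ∨ e₂ < z ∧ z < e₃ ∧ poleSum e₁ e₂ e₃ (remainder a α k) z = 0) := by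
  have hA := areaΓ_pos ha
  have hall : ∀ P : ℤ × ℤ → Prop, P p → P q → P r → ∀ m ∈ diracTriple, P m := by
    intro P h1 h2 h3 m hm
    rw [hT] at hm
    simp only [Finset.mem_insert, Finset.mem_singleton] at hm
    rcases hm with rfl | rfl | rfl <;> assumption
  have hsec : ∀ x < 2 * ‖diracPoint a‖ ^ 2, x ≠ e₁ → x ≠ e₂ → x ≠ e₃ →
      (∀ m, freeEigenvalue a k m ≠ x) ∧
      areaΓ a * (greenDiag a k x - α) = poleSum e₁ e₂ e₃ (remainder a α k) x := by
    intro x hx n1 n2 n3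
    have hne := hall (fun m => freeEigenvalue a k m ≠ x) (by rw [h1]; exact n1.symm)
      (by rw [h2]; exact n2.symm) (by rw [h3]; exact n3.symm)
    refine ⟨freeEigenvalue_ne ha hk hx hne, ?_⟩
    rw [secular_eq ha α hk hx hne, hT, Finset.sum_insert (by simp [hpq, hpr]),
      Finset.sum_insert (by simp [hqr]), Finset.sum_singleton, h1, h2, h3, poleSum]
    ring
  have hmem : p ∈ diracTriple ∧ q ∈ diracTriple ∧ r ∈ diracTriple := by rw [hT]; simp
  have h3c : e₃ < 2 * ‖diracPoint a‖ ^ 2 := h3 ▸ freeEigenvalue_lt_of_mem ha hk hmem.2.2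
  have he1 : 0 ≤ e₁ := h1 ▸ freeEigenvalue_nonneg a k p
  have hr : ∀ (N : Finset (ℤ × ℤ)) (mu : ℝ), N.Nonempty → N ⊆ {p, q, r} →
      (p ∈ N ↔ e₁ = mu) → (q ∈ N ↔ e₂ = mu) → (r ∈ N ↔ e₃ = mu) →
      Module.rank ℂ (eigenspace (scatterer a α k) mu) = (N.card - 1 : ℕ) := by
    intro N mu hN hsub i1 i2 i3
    refine rank_eigenspace_diracTriple ha α hk hN (hT ▸ hsub) ?_
    exact hall _ (by rw [h1, i1]) (by rw [h2, i2]) (by rw [h3, i3])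
  refine exists_isNthEigenvalue (scatterer a α k) h12 h23 h3c (monotoneOn_remainder ha α hk)
    (continuousOn_remainder ha α hk) ?_ ?_ ?_ ?_ ?_ ?_ ?_ ?_
  -- The secular function is negative far to the left because `g_lam → -∞`.
  · obtain ⟨l, hl1, hl2⟩ := (((tendsto_greenDiag_atBot ha k).eventually_lt_atBot
      (areaΓ a * α)).and (eventually_lt_atBot (0 : ℝ))).exists
    refine ⟨l, by linarith, ?_⟩
    rw [← (hsec l (by linarith) (by linarith) (by linarith) (by linarith)).2]
    linarith
  · intro x hx n1 n2 n3 h0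
    obtain ⟨i1, i2⟩ := hsec x hx n1 n2 n3
    rw [h0] at i2
    exact rank_eigenspace_eq_one ha i1 (sub_eq_zero.mp ((mul_eq_zero.mp i2).resolve_left hA.ne'))
  · intro x hx n1 n2 n3 h0
    obtain ⟨i1, i2⟩ := hsec x hx n1 n2 n3
    exact eigenspace_eq_bot ha i1 fun h => h0 (by rw [← i2, h, sub_self, mul_zero])
  · intro h
    -- A simple free eigenvalue has multiplicity `1 - 1 = 0` for the scatterer: its plane wave does
    -- not vanish at the origin.
    rw [← Submodule.rank_eq_zero (R := ℂ), hr {p} e₁ (by simp) (by simp) (by simp)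
      (by simpa [hpq.symm] using h.ne') (by simpa [hpr.symm] using (h.trans_le h23).ne')]
    simp
  · intro h h'
    rw [← Submodule.rank_eq_zero (R := ℂ), hr {q} e₂ (by simp) (by simp) (by simpa [hpq] using h.ne)
      (by simp) (by simpa [hqr.symm] using h'.ne')]
    simp
  · intro h h'
    rw [hr {p, q} e₂ (by simp) (by simp [Finset.insert_subset_iff]) (by simpa using h) (by simp)
      (by simpa [hpr.symm, hqr.symm] using h'.ne')]
    simp [hpq]
  · intro h h'
    rw [hr {q, r} e₂ (by simp) (by simp)
      (by simpa [hpq, hpr] using h.ne) (by simp) (by simpa using h'.symm)]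
    simp [hqr]
  · intro h h'
    rw [hr {p, q, r} e₂ (by simp) (by simp) (by simpa using h) (by simp) (by simpa using h'.symm)]
    simp [hpq, hpr, hqr]

/-- The second and third band are conical at the Dirac point, with quadratic error. -/
lemma bandFunction_near (ha : 0 < a) {M : ℝ}
    (hM : ∀ x, 0 ≤ x → x ≤ 2 * ‖diracPoint a‖ ^ 2 → |remainder a α k x| ≤ M)
    (hk : ‖k - diracPoint a‖ ≤ ‖diracPoint a‖ / 4)
    (hk' : M * (‖diracPoint a‖ * ‖k - diracPoint a‖) ≤ 1 / 2) :
    (IsNthEigenvalue (scatterer a α k) 2 (bandFunction a α 2 k) ∧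
      IsNthEigenvalue (scatterer a α k) 3 (bandFunction a α 3 k)) ∧
    |bandFunction a α 2 k - (‖diracPoint a‖ ^ 2 - ‖diracPoint a‖ * ‖k - diracPoint a‖)| ≤
      (1 + 43 * M * ‖diracPoint a‖ ^ 2) * ‖k - diracPoint a‖ ^ 2 ∧
    |bandFunction a α 3 k - (‖diracPoint a‖ ^ 2 + ‖diracPoint a‖ * ‖k - diracPoint a‖)| ≤
      (1 + 43 * M * ‖diracPoint a‖ ^ 2) * ‖k - diracPoint a‖ ^ 2 := by
  obtain ⟨p, q, r, hpq, hpr, hqr, hT, hle1, hle2⟩ := exists_sorted (freeEigenvalue a k)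
    (p := ((0 : ℤ), (0 : ℤ))) (q := ((-1 : ℤ), (0 : ℤ))) (r := ((-1 : ℤ), (-1 : ℤ)))
    (by simp) (by simp) (by simp)
  have hT : diracTriple = {p, q, r} := hT
  have hmem : p ∈ diracTriple ∧ q ∈ diracTriple ∧ r ∈ diracTriple := by rw [hT]; simp
  obtain ⟨hp, hq, hr⟩ := hmem
  have hsum : ∀ f : ℤ × ℤ → ℝ, ∑ m ∈ diracTriple, f m = f p + f q + f r := fun f => by
    rw [hT, Finset.sum_insert (by simp [hpq, hpr]), Finset.sum_insert (by simp [hqr]),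
      Finset.sum_singleton, add_assoc]
  obtain ⟨y, z, hy, hz, hy', hz'⟩ := exists_isNthEigenvalue_scatterer ha α hk hpq hpr hqr hT rfl rfl
    rfl hle1 hle2
  have hby : bandFunction a α 2 k = y := nthEigenvalue_eq _ hy
  have hbz : bandFunction a α 3 k = z := nthEigenvalue_eq _ hz
  rw [hby, hbz]
  refine ⟨⟨hy, hz⟩, ?_⟩
  have s1 := sum_splitting a k
  have s2 := sum_splitting_sq ha k
  rw [hsum] at s1 s2
  have h0 := freeEigenvalue_nonneg a k p
  have hc := freeEigenvalue_lt_of_mem ha hk hr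
  have hMy : |remainder a α k y| ≤ M := by
    apply hM <;> rcases hy' with ⟨i1, i2⟩ | ⟨i1, i2, -⟩ <;> linarith
  have hMz : |remainder a α k z| ≤ M := by
    apply hM <;> rcases hz' with ⟨i1, i2⟩ | ⟨i1, i2, -⟩ <;> linarith
  unfold poleSum at hy' hz'
  rw [freeEigenvalue_of_mem ha k hp, freeEigenvalue_of_mem ha k hq] at hle1
  rw [freeEigenvalue_of_mem ha k hq, freeEigenvalue_of_mem ha k hr] at hle2
  rw [freeEigenvalue_of_mem ha k hp, freeEigenvalue_of_mem ha k hq,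
    freeEigenvalue_of_mem ha k hr] at hy' hz'
  have hs : 0 ≤ ‖diracPoint a‖ * ‖k - diracPoint a‖ := by positivity
  -- The common shift of the three free eigenvalues. Its excess `‖k - K‖²` over `‖K‖²` accounts for
  -- the `1` in the error constant.
  set c := ‖diracPoint a‖ ^ 2 + ‖k - diracPoint a‖ ^ 2 with hcdef
  have e : ∀ d x : ℝ, d - (x - c) = c + d - x := fun d x => by ring
  have hy2 := first_zero_near (t := y - c) (by linarith) (by linarith) s1 s2 hs hk' hMy (by
    rw [e, e, e]
    rcases hy' with ⟨i1, i2⟩ | ⟨i1, i2, i3⟩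
    · left; constructor <;> linarith
    · exact Or.inr ⟨by linarith, by linarith, i3⟩)
  have hz2 := second_zero_near (t := z - c) (by linarith) (by linarith) s1 s2 hs hk' hMz (by
    rw [e, e, e]
    rcases hz' with ⟨i1, i2⟩ | ⟨i1, i2, i3⟩
    · left; constructor <;> linarith
    · exact Or.inr ⟨by linarith, by linarith, i3⟩)
  rw [abs_le] at hy2 hz2
  have hn : 0 ≤ ‖k - diracPoint a‖ ^ 2 := by positivity
  constructor <;> rw [abs_le] <;> constructor <;> nlinarith

end Bands

end PointScatterer

/-- The neighbourhoods are not punctured: at `k = K` the comparison function vanishes, so each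
`o`-relation forces `ν₂(K) = ν₃(K) = ‖K‖²`. Uniformity in the direction is also part of the
`o`-relations, since they hold along the full neighbourhood filter. -/
theorem mainTheorem3 (a : ℝ) (ha : 0 < a) (α : ℝ) :
    (∀ᶠ k in 𝓝 (PointScatterer.diracPoint a),
      PointScatterer.IsNthEigenvalue (PointScatterer.scatterer a α k) 2
          (PointScatterer.bandFunction a α 2 k) ∧
      PointScatterer.IsNthEigenvalue (PointScatterer.scatterer a α k) 3
          (PointScatterer.bandFunction a α 3 k)) ∧
    (fun k => PointScatterer.bandFunction a α 2 k -
        (‖PointScatterer.diracPoint a‖ ^ 2 -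
          4 * Real.pi / (3 * a) * ‖k - PointScatterer.diracPoint a‖))
      =o[𝓝 (PointScatterer.diracPoint a)] (fun k => ‖k - PointScatterer.diracPoint a‖) ∧
    (fun k => PointScatterer.bandFunction a α 3 k -
        (‖PointScatterer.diracPoint a‖ ^ 2 +
          4 * Real.pi / (3 * a) * ‖k - PointScatterer.diracPoint a‖))
      =o[𝓝 (PointScatterer.diracPoint a)] (fun k => ‖k - PointScatterer.diracPoint a‖) := by
  open PointScatterer in
  have hN := norm_diracPoint_pos ha
  obtain ⟨M, hM⟩ := exists_abs_remainder_le ha α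
  have hlim : Tendsto (fun k => ‖k - diracPoint a‖) (𝓝 (diracPoint a)) (𝓝 0) :=
    tendsto_iff_norm_sub_tendsto_zero.mp tendsto_id
  have hlim' : Tendsto (fun k => M * (‖diracPoint a‖ * ‖k - diracPoint a‖)) (𝓝 (diracPoint a))
      (𝓝 0) := by
    simpa using (hlim.const_mul ‖diracPoint a‖).const_mul M
  have key := ((hlim.eventually_le_const (by positivity : 0 < ‖diracPoint a‖ / 4)).and
    (hlim'.eventually_le_const (by norm_num : (0 : ℝ) < 1 / 2))).mono
    fun k hk => bandFunction_near ha (hM k hk.1) hk.1 hk.2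
  have hsq : (fun k => ‖k - diracPoint a‖ ^ 2) =o[𝓝 (diracPoint a)]
      fun k => ‖k - diracPoint a‖ := by
    have h1 := ((isLittleO_one_iff ℝ).mpr hlim).mul_isBigO
      (isBigO_refl (fun k => ‖k - diracPoint a‖) (𝓝 (diracPoint a)))
    simpa [sq] using h1
  rw [← norm_diracPoint ha]
  refine ⟨key.mono fun k hk => hk.1, ?_, ?_⟩
  · refine IsBigO.trans_isLittleO (IsBigO.of_bound (1 + 43 * M * ‖diracPoint a‖ ^ 2) ?_) hsq
    exact key.mono fun k hk => by simpa using hk.2.1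
  · refine IsBigO.trans_isLittleO (IsBigO.of_bound (1 + 43 * M * ‖diracPoint a‖ ^ 2) ?_) hsq
    exact key.mono fun k hk => by simpa using hk.2.2
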